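/- Let $n,k,m$ be integers with $n\ge 3$ and $0\le m<k\le n$. Let $\sigma_j^{(N)}$ be the $j$-th elementary symmetric function on $\mathbb R^N$ ($\sigma_0^{(N)}=1$, $\sigma_j^{(N)}=0$ for $j>N$), and let $\Gamma_k^N=\{x\in\mathbb R^N:\ \sigma_i^{(N)}(x)>0,\ i=1,\dots,k\}$. For $a=(a_1,\dots,a_m)\in\mathbb R^m$ put $$F(\lambda)=\sigma_k^{(n)}(\lambda)+\sum_{r=1}^m a_r\,\sigma_{k-r}^{(n)}(\lambda),\qquad \lambda\in\mathbb R^n,$$ with $F_i=\partial F/\partial\lambda_i$ and $F_{pq}=\partial^2F/\partial\lambda_p\partial\lambda_q$. Assume that the polynomial $P(t)=t^m+\sum_{r=1}^m(-1)^r a_r t^{m-r}$ has $m$ real roots (counted with multiplicity), and let $y=(y_1,\dots,y_m)$ be these roots. Let $\gamma=1/(1+16k)$. For every $n,k$ as above and every $s\in\mathbb R$ there are constants $\delta_0\in(0,1)$ and $\Lambda>0$, depending only on $n$, $k$ and $s$, such that the following holds for all $0<\delta\le\delta_0$, all $m<k$, and all $a$ and $y$ as above. Suppose that $(\lambda,y)\in\Gamma_k^{n+m}$,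 $\sigma_k^{(n+m)}(\lambda,y)=s$, $\lambda_1\ge\lambda_2\ge\cdots\ge\lambda_n\ge-\delta\lambda_1$, and that $\lambda_1$ is so large that $\lambda_1\ge\Lambda$ and $\lambda_1\ge\Lambda|y_j|$ for $j=1,\dots,m$. Then, for every $\xi\in\mathbb R^n$, $$-\sum_{p\ne q}\frac{F_{pq}\,\xi_p\xi_q}{F}+2\,\frac{\big(\sum_{i=1}^nF_i\xi_i\big)^2}{F^2}+2\sum_{i>1}\frac{F_i\,\xi_i^2}{(1+2\delta)\lambda_1F}\ \ge\ (1+\gamma)\,\frac{F_1\,\xi_1^2}{\lambda_1F},$$ where $F$, $F_i$ and $F_{pq}$ are evaluated at $\lambda$. -/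

import Mathlib

/-- The `k`-th elementary symmetric function `σ_k^{(n)}` on `ℝⁿ`;
`σ_0 = 1` and `σ_k^{(n)} = 0` for `k > n`. -/
noncomputable def sigma {n : ℕ} (k : ℕ) (x : Fin n → ℝ) : ℝ :=
  MvPolynomial.eval x (MvPolynomial.esymm (Fin n) ℝ k)

/-- The Garding cone `Γ_k^n`. -/
def gardingCone (k n : ℕ) : Set (Fin n → ℝ) :=
  {x | ∀ i : ℕ, 1 ≤ i → i ≤ k → 0 < sigma i x}

/-- The sum Hessian operator `F = σ_k + ∑_{r=1}^m a_r σ_{k-r}`, for `m < k`;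
the coefficient `a_r` is `a ⟨r - 1, _⟩`. -/
noncomputable def sumHessian {n m : ℕ} (k : ℕ) (a : Fin m → ℝ) (x : Fin n → ℝ) : ℝ :=
  sigma k x + ∑ r : Fin m, a r * sigma (k - ((r : ℕ) + 1)) x

/-- The polynomial `P(t) = t^m + ∑_{r=1}^m (-1)^r a_r t^{m-r}`. -/
noncomputable def rootPolynomial {m : ℕ} (a : Fin m → ℝ) : Polynomial ℝ :=
  Polynomial.X ^ m + ∑ r : Fin m,
    Polynomial.C ((-1 : ℝ) ^ ((r : ℕ) + 1) * a r) * Polynomial.X ^ (m - ((r : ℕ) + 1))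

/-- The polynomial `P` has the `m` real roots `y_1, …, y_m`, listed with multiplicity. -/
def HasRealRoots {m : ℕ} (a y : Fin m → ℝ) : Prop :=
  (rootPolynomial a).roots = Finset.univ.val.map y

/-- The partial derivative `∂f/∂x_i`. -/
noncomputable def partialD {n : ℕ} (i : Fin n) (f : (Fin n → ℝ) → ℝ) (x : Fin n → ℝ) : ℝ :=
  lineDeriv ℝ f x (Pi.single i 1)

open Finset

/-! By Vieta, `a_r` is the `r`-th elementary symmetric function of the roots `y`, so `F(λ) = σ_k(λ,
y)`: the operator is a plain `σ_k` in `n + m ≤ 2n` variables with `y` frozen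
(`HasRealRoots.sumHessian_eq`). Extending `ξ` by zero and dividing by `λ_1`, one has to prove the
inequality for `σ_k` at a point `x` of `Γ_k` with `x_1 = 1`, all `|x_i| ≤ 1`, all `x_i ≥ -η` and
`σ_k(x) ≤ η`, where `η` may be taken as small as desired.

Write `k = K + 2`, `σ = σ_k(x)`, `σ_i` for its first derivatives, `G = σ_1` for the derivative in
the largest variable, and `g = G - σ`. Log-concavity, `σ · D²σ(ζ, ζ) ≤ (Dσ(ζ))²`
(`InCone.mul_hessian_le_sq`), is applied to `ζ = ξ - tχ` for a test vector `χ` such that `D²σ χ = C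
∇σ + ρ` with `ρ` under control (`InCone.hessian_lower_bound`). Optimising over `t` leaves the single
inequality `ρ_1² ≥ (1 + γ) G D` for an explicit `D`.

The smallness of `σ` enters through `exists_isSplitting`: at most `k - 1` variables are not small,
and by pigeonhole a set `A` of large ones is separated from the rest by a quadratic gap. The test
vector is `(1 + c) e_1 - z x - w ∑_{i ∉ A} x_i² e_i` with `z = 1/(k + 1)` and `w = 1/(k + 1 - |A|)`.
Up to small errors, `ρ_1 = -(G + g)`, `ρ_i = 0` for the other `i ∈ A`, and `ρ_i = 2 w x_i σ_i` off
`A`, which leads to `D = (1 - z) G + (2 + z) g`. With `u = g/G`, `(1 + u)² - ((1 - z) + (2 + z) u) =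
(u - z/2)² + z - z²/4`, a margin of order `1/(k + 1)`, which pays for `γ` and for all errors
(`IsSplitting.concavity`). -/

/-- The elementary symmetric function of degree `k` in the variables `x i`, `i ∈ S`. -/
def esymmOn {ι R : Type*} [CommRing R] (x : ι → R) (S : Finset ι) (k : ℕ) : R :=
  ∑ T ∈ S.powersetCard k, ∏ i ∈ T, x i

/-! ### Identities for elementary symmetric functions over finite index sets. -/

section Basic

variable {ι R : Type*} [CommRing R]

@[simp] theorem esymmOn_zero (x : ι → R) (S : Finset ι) : esymmOn x S 0 = 1 := by
  simp [esymmOn]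

theorem esymmOn_one (x : ι → R) (S : Finset ι) : esymmOn x S 1 = ∑ i ∈ S, x i := by
  simp [esymmOn, Finset.powersetCard_one]

theorem esymmOn_eq_zero (x : ι → R) {S : Finset ι} {k : ℕ} (h : S.card < k) :
    esymmOn x S k = 0 := by
  rw [esymmOn, Finset.powersetCard_eq_empty.2 h, Finset.sum_empty]

theorem esymmOn_empty_succ (x : ι → R) (k : ℕ) : esymmOn x ∅ (k + 1) = 0 :=
  esymmOn_eq_zero x (by simp)

theorem esymmOn_smul (c : R) (x : ι → R) (S : Finset ι) (k : ℕ) :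
    esymmOn (fun i => c * x i) S k = c ^ k * esymmOn x S k := by
  unfold esymmOn
  rw [Finset.mul_sum]
  refine Finset.sum_congr rfl fun T hT => ?_
  rw [Finset.prod_mul_distrib, Finset.prod_const, (Finset.mem_powersetCard.1 hT).2]

theorem map_esymmOn {R' : Type*} [CommRing R'] (f : R →+* R') (x : ι → R) (S : Finset ι)
    (k : ℕ) : f (esymmOn x S k) = esymmOn (fun i => f (x i)) S k := by
  simp [esymmOn, map_sum, map_prod]

theorem esymmOn_congr {x y : ι → R} {S : Finset ι} (h : ∀ i ∈ S, x i = y i) (k : ℕ) :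
    esymmOn x S k = esymmOn y S k := by
  unfold esymmOn
  refine Finset.sum_congr rfl fun T hT => Finset.prod_congr rfl fun i hi => ?_
  exact h i ((Finset.mem_powersetCard.1 hT).1 hi)

variable [DecidableEq ι]

theorem esymmOn_insert (x : ι → R) {S : Finset ι} {a : ι} (ha : a ∉ S) (k : ℕ) :
    esymmOn x (insert a S) (k + 1) = esymmOn x S (k + 1) + x a * esymmOn x S k := by
  unfold esymmOn
  rw [Finset.powersetCard_succ_insert ha, Finset.sum_union, Finset.sum_image, Finset.mul_sum]
  · congr 1
    refine Finset.sum_congr rfl fun T hT => ?_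
    rw [Finset.prod_insert fun h => ha ((Finset.mem_powersetCard.1 hT).1 h)]
  · intro T hT T' hT' h
    have h1 : a ∉ T := fun h => ha ((Finset.mem_powersetCard.1 hT).1 h)
    have h2 : a ∉ T' := fun h => ha ((Finset.mem_powersetCard.1 hT').1 h)
    rw [← Finset.erase_insert h1, ← Finset.erase_insert h2, h]
  · rw [Finset.disjoint_left]
    intro T hT hT'
    obtain ⟨T', -, rfl⟩ := Finset.mem_image.1 hT'
    exact ha ((Finset.mem_powersetCard.1 hT).1 (Finset.mem_insert_self _ _))

theorem esymmOn_erase (x : ι → R) {S : Finset ι} {a : ι} (ha : a ∈ S) (k : ℕ) :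
    esymmOn x S (k + 1) = esymmOn x (S.erase a) (k + 1) + x a * esymmOn x (S.erase a) k := by
  rw [← esymmOn_insert x (Finset.notMem_erase a S), Finset.insert_erase ha]

/-- Euler's identity for a form of degree `k + 1`. -/
theorem sum_mul_esymmOn_erase (x : ι → R) (S : Finset ι) (k : ℕ) :
    ∑ i ∈ S, x i * esymmOn x (S.erase i) k = (k + 1) * esymmOn x S (k + 1) := by
  induction S using Finset.induction_on generalizing k with
  | empty => simp [esymmOn_empty_succ]
  | insert a S ha ih =>
    have key : ∀ i ∈ S, x i * esymmOn x ((insert a S).erase i) k =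
        x i * esymmOn x (insert a (S.erase i)) k := by
      intro i hi
      rw [Finset.erase_insert_of_ne (by rintro rfl; exact ha hi)]
    rw [Finset.sum_insert ha, Finset.erase_insert ha, Finset.sum_congr rfl key]
    cases k with
    | zero =>
      simp only [esymmOn_zero, mul_one, zero_add, Nat.cast_zero, one_mul, esymmOn_one]
      rw [Finset.sum_insert ha]
    | succ k =>
      have key2 : ∀ i ∈ S, x i * esymmOn x (insert a (S.erase i)) (k + 1) =
          x i * esymmOn x (S.erase i) (k + 1) + x a * (x i * esymmOn x (S.erase i) k) := by
        intro i hi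
        rw [esymmOn_insert x (by simp [ha])]
        ring
      rw [Finset.sum_congr rfl key2, Finset.sum_add_distrib, ← Finset.mul_sum, ih, ih,
        esymmOn_insert x ha]
      push_cast
      ring

theorem sum_sq_mul_esymmOn_erase (x : ι → R) (S : Finset ι) (k : ℕ) :
    ∑ i ∈ S, x i ^ 2 * esymmOn x (S.erase i) k =
      esymmOn x S 1 * esymmOn x S (k + 1) - (k + 2) * esymmOn x S (k + 2) := by
  have h1 : ∀ i ∈ S, x i ^ 2 * esymmOn x (S.erase i) k =
      x i * esymmOn x S (k + 1) - x i * esymmOn x (S.erase i) (k + 1) := by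
    intro i hi
    rw [esymmOn_erase x hi]
    ring
  rw [Finset.sum_congr rfl h1, Finset.sum_sub_distrib, ← Finset.sum_mul,
    sum_mul_esymmOn_erase, esymmOn_one]
  push_cast
  ring

end Basic

/-! ### Newton's inequality from real-rootedness. -/

section Newton

variable {ι : Type*} [DecidableEq ι]

open Polynomial in
theorem coeff_prod_one_add_C_mul_X (x : ι → ℝ) (S : Finset ι) (k : ℕ) :
    (∏ i ∈ S, (1 + C (x i) * X)).coeff k = esymmOn x S k := by
  induction S using Finset.induction_on generalizing k with
  | empty =>
    cases k with
    | zero => simp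
    | succ k => simp [esymmOn_empty_succ, Polynomial.coeff_one]
  | insert a S ha ih =>
    rw [Finset.prod_insert ha, add_mul, one_mul, mul_assoc, coeff_add, coeff_C_mul, ih]
    cases k with
    | zero => simp
    | succ k => rw [coeff_X_mul, ih, esymmOn_insert x ha]

open Polynomial in
theorem splits_derivative_real {p : ℝ[X]} (hp : p.Splits) : (derivative p).Splits := by
  rw [splits_iff_card_roots] at hp ⊢
  have h1 := card_roots_le_derivative p
  have h2 := card_roots' (derivative p)
  have h3 := natDegree_derivative_le p
  omega

open Polynomial in
theorem splits_iterate_derivative_real {p : ℝ[X]} (hp : p.Splits) (n : ℕ) :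
    (derivative^[n] p).Splits := by
  induction n with
  | zero => simpa
  | succ n ih => rw [Function.iterate_succ_apply']; exact splits_derivative_real ih

-- Laguerre's inequality. Splitting off a root `a`, `p = (X - a) r`, turns `p'² - p p''` into `r² +
-- (t - a)² (r'² - r r'')`, which is nonnegative by induction on the roots.
open Polynomial in
theorem eval_mul_eval_derivative_two_le {p : ℝ[X]} (hp : p.Splits) (t : ℝ) :
    p.eval t * (derivative (derivative p)).eval t ≤ (derivative p).eval t ^ 2 := by
  rw [hp.eq_prod_roots]
  generalize p.leadingCoeff = c
  generalize p.roots = s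
  induction s using Multiset.induction_on with
  | empty => simp
  | cons a s ih =>
    rw [Multiset.map_cons, Multiset.prod_cons, mul_left_comm]
    generalize C c * (Multiset.map (fun x => X - C x) s).prod = r at ih
    simp only [derivative_mul, derivative_sub, derivative_X, derivative_C, derivative_add,
      eval_add, eval_mul, eval_sub, eval_X, eval_C, sub_zero,
      one_mul]
    nlinarith [sq_nonneg (eval t r), mul_nonneg (sq_nonneg (t - a)) (sub_nonneg.2 ih)]

open Polynomial in
/-- Newton's inequality, with the constant relaxed to `1`. -/
theorem esymmOn_mul_esymmOn_le_sq (x : ι → ℝ) (S : Finset ι) (k : ℕ) :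
    esymmOn x S k * esymmOn x S (k + 2) ≤ esymmOn x S (k + 1) ^ 2 := by
  have hs : (∏ i ∈ S, (1 + C (x i) * X)).Splits := by
    refine Splits.prod fun i _ => ?_
    refine Splits.of_natDegree_le_one ?_
    compute_degree
  -- The derivatives of `∏ (1 + x_i X)` are again real-rooted; at `0` they are factorials times
  -- elementary symmetric functions.
  have h := eval_mul_eval_derivative_two_le (splits_iterate_derivative_real hs k) 0
  have e : ∀ j, (derivative^[j] (∏ i ∈ S, (1 + C (x i) * X))).eval 0
      = (j.factorial : ℝ) * esymmOn x S j := by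
    intro j
    rw [← coeff_zero_eq_eval_zero, coeff_iterate_derivative, zero_add, Nat.descFactorial_self,
      coeff_prod_one_add_C_mul_X, nsmul_eq_mul]
  rw [← Function.iterate_succ_apply' derivative, ← Function.iterate_succ_apply' derivative,
    e, e, e] at h
  set a := esymmOn x S k
  set b := esymmOn x S (k + 1)
  set c := esymmOn x S (k + 2)
  have hf : (0 : ℝ) < k.factorial := by positivity
  simp only [Nat.succ_eq_add_one, Nat.factorial_succ, Nat.cast_mul] at h
  push_cast at h
  have h' : ((k : ℝ) + 2) * (a * c) ≤ ((k : ℝ) + 1) * b ^ 2 := by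
    have : ((k.factorial : ℝ) ^ 2 * (k + 1)) * (((k : ℝ) + 2) * (a * c)) ≤
        ((k.factorial : ℝ) ^ 2 * (k + 1)) * (((k : ℝ) + 1) * b ^ 2) := by
      calc _ = (k.factorial : ℝ) * a * (((k : ℝ) + 1 + 1) * ((k + 1) * k.factorial) * c) := by ring
        _ ≤ _ := h
        _ = _ := by ring
    exact le_of_mul_le_mul_left this (by positivity)
  have hk : (0 : ℝ) ≤ k := Nat.cast_nonneg k
  rcases le_or_gt (a * c) 0 with hac | hac
  · exact hac.trans (sq_nonneg b)
  · nlinarith [sq_nonneg b]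

end Newton

/-! ### The Gårding cone and deletion of variables. -/

section Cone

variable {ι : Type*}

/-- The Gårding cone `Γ_k` in the variables `x i`, `i ∈ S`. -/
def InCone (x : ι → ℝ) (S : Finset ι) (k : ℕ) : Prop :=
  ∀ i ≤ k, 0 < esymmOn x S i

theorem InCone.mono {x : ι → ℝ} {S : Finset ι} {k l : ℕ} (h : InCone x S k) (hl : l ≤ k) :
    InCone x S l := fun i hi => h i (hi.trans hl)

variable [DecidableEq ι]

/-- Let `p, q, r` be consecutive symmetric functions after deleting `a`, with `q ≤ 0 < p`. Then `p
(r + x_a q) > 0` and `-q (q + x_a p) ≥ 0` add up to `p r > q²`, against Newton. -/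
theorem InCone.erase {x : ι → ℝ} {S : Finset ι} {k : ℕ} (h : InCone x S (k + 1)) {a : ι}
    (ha : a ∈ S) : InCone x (S.erase a) k := by
  intro i
  induction i with
  | zero => simp
  | succ i ih =>
    intro hi
    have h0 := ih (by omega)
    by_contra hneg
    push Not at hneg
    have h1 := h (i + 1) (by omega)
    have h2 := h (i + 2) (by omega)
    rw [esymmOn_erase x ha] at h1 h2
    have h3 := esymmOn_mul_esymmOn_le_sq x (S.erase a) i
    set p := esymmOn x (S.erase a) i
    set q := esymmOn x (S.erase a) (i + 1)
    set r := esymmOn x (S.erase a) (i + 2)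
    nlinarith [mul_pos h0 h2, mul_nonneg (neg_nonneg.2 hneg) h1.le]

theorem InCone.sdiff {x : ι → ℝ} {S : Finset ι} {k : ℕ} (U : Finset ι) (hU : U ⊆ S)
    (h : InCone x S (k + U.card)) : InCone x (S \ U) k := by
  induction U using Finset.induction_on generalizing k with
  | empty => simpa using h
  | insert a U ha ih =>
    rw [Finset.card_insert_of_notMem ha] at h
    have h1 := ih ((Finset.subset_insert _ _).trans hU) (k := k + 1) (by convert h using 1; omega)
    have h2 := h1.erase (a := a) (by
      rw [Finset.mem_sdiff]; exact ⟨hU (Finset.mem_insert_self _ _), ha⟩)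
    rwa [← Finset.sdiff_insert] at h2

end Cone

/-! ### Concavity of quotients and log-concavity along lines. -/

section LogConcave

variable {ι : Type*}

open Polynomial in
/-- The elementary symmetric function along the line `x + tξ`, as a polynomial in `t`. -/
noncomputable def esymmLine (x ξ : ι → ℝ) (S : Finset ι) (k : ℕ) : ℝ[X] :=
  esymmOn (fun i => C (x i) + C (ξ i) * X) S k

theorem esymmLine_coeff_zero (x ξ : ι → ℝ) (S : Finset ι) (k : ℕ) :
    (esymmLine x ξ S k).coeff 0 = esymmOn x S k := by
  rw [Polynomial.coeff_zero_eq_eval_zero]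
  have := map_esymmOn (Polynomial.evalRingHom (0 : ℝ))
    (fun i => Polynomial.C (x i) + Polynomial.C (ξ i) * Polynomial.X) S k
  simpa [esymmLine] using this

variable [DecidableEq ι]

theorem esymmLine_erase_coeff_zero (x ξ : ι → ℝ) {S : Finset ι} {a : ι} (ha : a ∈ S) (k : ℕ) :
    (esymmLine x ξ S (k + 1)).coeff 0 = (esymmLine x ξ (S.erase a) (k + 1)).coeff 0 +
      x a * (esymmLine x ξ (S.erase a) k).coeff 0 := by
  simp only [esymmLine_coeff_zero]
  exact esymmOn_erase x ha k

open Polynomial in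
theorem coeff_linear_mul (a b : ℝ) (p : ℝ[X]) (n : ℕ) :
    ((C a + C b * X) * p).coeff (n + 1) = a * p.coeff (n + 1) + b * p.coeff n := by
  rw [add_mul, coeff_add, coeff_C_mul, mul_assoc, coeff_C_mul, coeff_X_mul]

theorem esymmLine_erase_coeff_succ (x ξ : ι → ℝ) {S : Finset ι} {a : ι} (ha : a ∈ S)
    (k n : ℕ) :
    (esymmLine x ξ S (k + 1)).coeff (n + 1) = (esymmLine x ξ (S.erase a) (k + 1)).coeff (n + 1) +
      (x a * (esymmLine x ξ (S.erase a) k).coeff (n + 1) +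
        ξ a * (esymmLine x ξ (S.erase a) k).coeff n) := by
  unfold esymmLine
  rw [esymmOn_erase _ ha, Polynomial.coeff_add, coeff_linear_mul]

theorem sum_esymmLine_coeff_succ (x ξ : ι → ℝ) (S : Finset ι) (k n : ℕ) :
    ∑ i ∈ S, (x i * (esymmLine x ξ (S.erase i) k).coeff (n + 1) +
        ξ i * (esymmLine x ξ (S.erase i) k).coeff n) =
      (k + 1) * (esymmLine x ξ S (k + 1)).coeff (n + 1) := by
  have h := congrArg (fun p => Polynomial.coeff p (n + 1))
    (sum_mul_esymmOn_erase (fun i => Polynomial.C (x i) + Polynomial.C (ξ i) * Polynomial.X) S k)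
  simp only [Polynomial.finsetSum_coeff, coeff_linear_mul] at h
  have h2 : ((k : Polynomial ℝ) + 1) = Polynomial.C ((k : ℝ) + 1) := by simp
  rw [h2, Polynomial.coeff_C_mul] at h
  exact h

/-- Concavity of `σ_{k+1} / σ_k` on `Γ_k`, as an inequality between the Taylor coefficients of
numerator and denominator along a line. -/
theorem esymmLine_quotient_concave (x ξ : ι → ℝ) (k : ℕ) (S : Finset ι) (h : InCone x S k) :
    (esymmLine x ξ S k).coeff 0 ^ 2 * (esymmLine x ξ S (k + 1)).coeff 2
      - (esymmLine x ξ S k).coeff 0 * (esymmLine x ξ S k).coeff 1 *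
          (esymmLine x ξ S (k + 1)).coeff 1
      - (esymmLine x ξ S k).coeff 0 * (esymmLine x ξ S k).coeff 2 *
          (esymmLine x ξ S (k + 1)).coeff 0
      + (esymmLine x ξ S k).coeff 1 ^ 2 * (esymmLine x ξ S (k + 1)).coeff 0 ≤ 0 := by
  induction k generalizing S with
  | zero =>
    have h1 := sum_esymmLine_coeff_succ x ξ S 0 1
    have h0 : ∀ T : Finset ι, esymmLine x ξ T 0 = 1 := by intro T; simp [esymmLine]
    simp only [h0, Polynomial.coeff_one] at h1 ⊢
    simp at h1 ⊢
    linarith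
  | succ k ih =>
    have hs0 : ∑ i ∈ S, x i * (esymmLine x ξ (S.erase i) (k + 1)).coeff 0 =
        ((k + 1 : ℕ) + 1) * (esymmLine x ξ S (k + 2)).coeff 0 := by
      simp only [esymmLine_coeff_zero]
      exact sum_mul_esymmOn_erase x S (k + 1)
    have hs1 := sum_esymmLine_coeff_succ x ξ S (k + 1) 0
    have hs2 := sum_esymmLine_coeff_succ x ξ S (k + 1) 1
    set G0 := (esymmLine x ξ S (k + 1)).coeff 0 with hG0
    set G1 := (esymmLine x ξ S (k + 1)).coeff 1 with hG1
    set G2 := (esymmLine x ξ S (k + 1)).coeff 2 with hG2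
    set H0 := (esymmLine x ξ S (k + 1 + 1)).coeff 0
    set H1 := (esymmLine x ξ S (k + 1 + 1)).coeff 1
    set H2 := (esymmLine x ξ S (k + 1 + 1)).coeff 2
    have hk : (0 : ℝ) < ((k + 1 : ℕ) + 1) := by positivity
    have hG0pos : 0 < G0 := by rw [hG0, esymmLine_coeff_zero]; exact h _ le_rfl
    -- By Euler's identity the quotient is a positive multiple of a sum of terms `x_i σ_{k+1}(S \ i)
    -- / σ_{k+1}(S)`. Each is the parallel sum `x_i q / (x_i + q)` of `x_i` and `q = σ_{k+1}(S \ i)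
    -- / σ_k(S \ i)`; it is concave in the pair and nondecreasing in `q`, and `q` is concave by
    -- induction.
    have hterm : ∀ i ∈ S,
        G0 ^ 2 * (x i * (esymmLine x ξ (S.erase i) (k + 1)).coeff 2 +
          ξ i * (esymmLine x ξ (S.erase i) (k + 1)).coeff 1)
        - G0 * G1 * (x i * (esymmLine x ξ (S.erase i) (k + 1)).coeff 1 +
          ξ i * (esymmLine x ξ (S.erase i) (k + 1)).coeff 0)
        + (G1 ^ 2 - G0 * G2) * (x i * (esymmLine x ξ (S.erase i) (k + 1)).coeff 0) ≤ 0 := by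
      intro i hi
      have e0 := esymmLine_erase_coeff_zero x ξ hi k
      have e1 := esymmLine_erase_coeff_succ x ξ hi k 0
      have e2 := esymmLine_erase_coeff_succ x ξ hi k 1
      have hc := h.erase hi
      have hQ := ih _ hc
      have hJ : 0 < (esymmLine x ξ (S.erase i) k).coeff 0 := by
        rw [esymmLine_coeff_zero]; exact hc _ le_rfl
      rw [← hG0] at e0
      simp only [zero_add, Nat.reduceAdd] at e1 e2
      rw [← hG1] at e1
      rw [← hG2] at e2
      set g0 := (esymmLine x ξ (S.erase i) (k + 1)).coeff 0
      set g1 := (esymmLine x ξ (S.erase i) (k + 1)).coeff 1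
      set g2 := (esymmLine x ξ (S.erase i) (k + 1)).coeff 2
      set j0 := (esymmLine x ξ (S.erase i) k).coeff 0
      set j1 := (esymmLine x ξ (S.erase i) k).coeff 1
      set j2 := (esymmLine x ξ (S.erase i) k).coeff 2
      have hid : j0 * (G0 ^ 2 * (x i * g2 + ξ i * g1) - G0 * G1 * (x i * g1 + ξ i * g0)
          + (G1 ^ 2 - G0 * G2) * (x i * g0)) =
          G0 * x i ^ 2 * (j0 ^ 2 * g2 - j0 * j1 * g1 - j0 * j2 * g0 + j1 ^ 2 * g0)
            - (x i * (g1 * j0 - g0 * j1) - ξ i * g0 * j0) ^ 2 := by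
        rw [e0, e1, e2]; ring
      have hle : j0 * (G0 ^ 2 * (x i * g2 + ξ i * g1) - G0 * G1 * (x i * g1 + ξ i * g0)
          + (G1 ^ 2 - G0 * G2) * (x i * g0)) ≤ 0 := by
        rw [hid]
        have := mul_nonpos_of_nonneg_of_nonpos (mul_nonneg hG0pos.le (sq_nonneg (x i))) hQ
        nlinarith [sq_nonneg (x i * (g1 * j0 - g0 * j1) - ξ i * g0 * j0)]
      exact nonpos_of_mul_nonpos_right hle hJ
    have hsum := Finset.sum_nonpos hterm
    rw [Finset.sum_add_distrib, Finset.sum_sub_distrib, ← Finset.mul_sum, ← Finset.mul_sum,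
      ← Finset.mul_sum, hs0, hs1, hs2] at hsum
    refine nonpos_of_mul_nonpos_right (a := ((k + 1 : ℕ) : ℝ) + 1) ?_ hk
    calc _ = _ := ?_
      _ ≤ 0 := hsum
    ring

/-- Log-concavity of `σ_k` on `Γ_k`. -/
theorem esymmLine_log_concave (x ξ : ι → ℝ) (k : ℕ) (S : Finset ι) (h : InCone x S k) :
    2 * ((esymmLine x ξ S k).coeff 0 * (esymmLine x ξ S k).coeff 2) ≤
      (esymmLine x ξ S k).coeff 1 ^ 2 := by
  induction k with
  | zero => simp [esymmLine, Polynomial.coeff_one]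
  | succ k ih =>
    have hQ := esymmLine_quotient_concave x ξ k S (h.mono k.le_succ)
    have h1 := ih (h.mono k.le_succ)
    have hG : 0 < (esymmLine x ξ S k).coeff 0 := by
      rw [esymmLine_coeff_zero]; exact h k k.le_succ
    have hH : 0 < (esymmLine x ξ S (k + 1)).coeff 0 := by
      rw [esymmLine_coeff_zero]; exact h _ le_rfl
    set G0 := (esymmLine x ξ S k).coeff 0
    set G1 := (esymmLine x ξ S k).coeff 1
    set G2 := (esymmLine x ξ S k).coeff 2
    set H0 := (esymmLine x ξ S (k + 1)).coeff 0
    set H1 := (esymmLine x ξ S (k + 1)).coeff 1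
    set H2 := (esymmLine x ξ S (k + 1)).coeff 2
    -- This is `log H = log G + log (H / G)`: a concave positive quotient has a concave logarithm.
    have h2 : G0 ^ 2 * (2 * (H0 * H2)) ≤ G0 ^ 2 * H1 ^ 2 := by
      nlinarith [mul_nonneg hH.le (sub_nonneg.2 hQ), mul_nonneg (sq_nonneg H0) (sub_nonneg.2 h1),
        sq_nonneg (G0 * H1 - G1 * H0)]
    exact le_of_mul_le_mul_left h2 (by positivity)

end LogConcave

/-! ### Taylor coefficients along a line as gradient and Hessian sums. -/

section QuadraticForm

variable {ι : Type*} [DecidableEq ι]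

open Polynomial in
theorem derivative_esymmLine (x ξ : ι → ℝ) (S : Finset ι) (k : ℕ) :
    derivative (esymmLine x ξ S (k + 1)) =
      ∑ i ∈ S, C (ξ i) * esymmLine x ξ (S.erase i) k := by
  have hins : ∀ (T : Finset ι) (a : ι) (n : ℕ), a ∉ T → esymmLine x ξ (insert a T) (n + 1) =
      esymmLine x ξ T (n + 1) + (C (x a) + C (ξ a) * X) * esymmLine x ξ T n :=
    fun T a n ha => esymmOn_insert _ ha n
  induction S using Finset.induction_on generalizing k with
  | empty => simp [esymmLine, esymmOn_empty_succ]
  | insert a S ha ih =>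
    have key : ∀ i ∈ S, C (ξ i) * esymmLine x ξ ((insert a S).erase i) k =
        C (ξ i) * esymmLine x ξ (insert a (S.erase i)) k := by
      intro i hi
      rw [Finset.erase_insert_of_ne (by rintro rfl; exact ha hi)]
    rw [Finset.sum_insert ha, Finset.erase_insert ha, Finset.sum_congr rfl key, hins S a k ha,
      derivative_add, derivative_mul, ih]
    cases k with
    | zero => simp [esymmLine]; ring
    | succ k =>
      have key2 : ∀ i ∈ S, C (ξ i) * esymmLine x ξ (insert a (S.erase i)) (k + 1) =
          C (ξ i) * esymmLine x ξ (S.erase i) (k + 1) +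
            (C (x a) + C (ξ a) * X) * (C (ξ i) * esymmLine x ξ (S.erase i) k) := by
        intro i hi
        rw [hins _ _ _ (by simp [ha])]
        ring
      rw [Finset.sum_congr rfl key2, Finset.sum_add_distrib, ← Finset.mul_sum, ih]
      simp
      ring

theorem esymmLine_coeff_one (x ξ : ι → ℝ) (S : Finset ι) (k : ℕ) :
    (esymmLine x ξ S (k + 1)).coeff 1 = ∑ i ∈ S, ξ i * esymmOn x (S.erase i) k := by
  have h := congrArg (fun p => Polynomial.coeff p 0) (derivative_esymmLine x ξ S k)
  simp only [Polynomial.coeff_derivative, Polynomial.finsetSum_coeff, Polynomial.coeff_C_mul,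
    esymmLine_coeff_zero] at h
  simpa using h

theorem two_mul_esymmLine_coeff_two (x ξ : ι → ℝ) (S : Finset ι) (k : ℕ) :
    2 * (esymmLine x ξ S (k + 2)).coeff 2 =
      ∑ p ∈ S, ∑ q ∈ S.erase p, ξ p * ξ q * esymmOn x ((S.erase p).erase q) k := by
  have h := congrArg (fun p => Polynomial.coeff p 1) (derivative_esymmLine x ξ S (k + 1))
  simp only [Polynomial.coeff_derivative, Polynomial.finsetSum_coeff, Polynomial.coeff_C_mul,
    esymmLine_coeff_one, Finset.mul_sum] at h
  norm_num at h
  rw [mul_comm, h]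
  exact Finset.sum_congr rfl fun p _ => Finset.sum_congr rfl fun q _ => by ring

/-- Log-concavity of `σ_{k+2}` on its Gårding cone, written with first and second partial
derivatives. -/
theorem InCone.mul_hessian_le_sq {x : ι → ℝ} {S : Finset ι} {k : ℕ} (h : InCone x S (k + 2))
    (ξ : ι → ℝ) :
    esymmOn x S (k + 2) *
        ∑ p ∈ S, ∑ q ∈ S.erase p, ξ p * ξ q * esymmOn x ((S.erase p).erase q) k ≤
      (∑ i ∈ S, ξ i * esymmOn x (S.erase i) (k + 1)) ^ 2 := by
  have := esymmLine_log_concave x ξ (k + 2) S h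
  rw [esymmLine_coeff_zero, esymmLine_coeff_one] at this
  rw [← two_mul_esymmLine_coeff_two]
  linarith

end QuadraticForm

/-! ### The set of largest variables. -/

section TopSet

variable {ι : Type*}

/-- `U` collects the largest variables, `j` carries the largest of the remaining ones, and the
remaining variables are controlled by `x j`. -/
structure IsTopSet (x : ι → ℝ) (N : ℕ) (S U : Finset ι) (j : ι) : Prop where
  card_le : S.card ≤ N
  subset : U ⊆ S
  mem : j ∈ S
  notMem : j ∉ U
  pos : 0 < x j
  le_of_mem : ∀ u ∈ U, x j ≤ x u
  le_of_notMem : ∀ v ∈ S, v ∉ U → x v ≤ x j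
  abs_le : ∀ v ∈ S, v ∉ U → |x v| ≤ N * x j

theorem IsTopSet.pos_of_mem {x : ι → ℝ} {N : ℕ} {S U : Finset ι} {j : ι}
    (h : IsTopSet x N S U j) {u : ι} (hu : u ∈ U) : 0 < x u := h.pos.trans_le (h.le_of_mem u hu)

theorem IsTopSet.one_le {x : ι → ℝ} {N : ℕ} {S U : Finset ι} {j : ι}
    (h : IsTopSet x N S U j) : 1 ≤ N :=
  (Finset.card_pos.2 ⟨j, h.mem⟩).trans_le h.card_le

theorem IsTopSet.top {x : ι → ℝ} {N : ℕ} {S U : Finset ι} {j : ι} (h : IsTopSet x N S U j)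
    {u : ι} (hu : u ∈ U) {v : ι} (hv : v ∈ S) (hvU : v ∉ U) : x v ≤ x u :=
  (h.le_of_notMem v hv hvU).trans (h.le_of_mem u hu)

theorem IsTopSet.one_le_const {x : ι → ℝ} {N : ℕ} {S U : Finset ι} {j : ι}
    (T : IsTopSet x N S U j) : (1 : ℝ) ≤ 2 * N := by
  have : (1 : ℝ) ≤ N := by exact_mod_cast T.one_le
  linarith

end TopSet

/-! ### Bounds by products of the largest variables, and the gap between scales. -/

section Estimates

variable {ι : Type*} [DecidableEq ι]

/-- One term of the nonnegative sum in `sum_sq_mul_esymmOn_erase` over `S \ i` is at most the whole;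
positivity of `σ_{K+2}(S)` gives `-σ_{K+2}(S \ i) < x_i σ_{K+1}(S \ i)`. -/
theorem InCone.sq_mul_esymmOn_erase_erase_le {x : ι → ℝ} {S : Finset ι} {K : ℕ}
    (h : InCone x S (K + 2)) {i j : ι} (hi : i ∈ S) (hj : j ∈ S) (hij : j ≠ i) :
    x j ^ 2 * esymmOn x ((S.erase i).erase j) K ≤
      (esymmOn x (S.erase i) 1 + (K + 2) * x i) * esymmOn x (S.erase i) (K + 1) := by
  have h1 := sum_sq_mul_esymmOn_erase x (S.erase i) K
  have h2 := h (K + 2) le_rfl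
  rw [esymmOn_erase x hi] at h2
  have h3 := Finset.single_le_sum
    (f := fun l => x l ^ 2 * esymmOn x ((S.erase i).erase l) K)
    (fun l hl => mul_nonneg (sq_nonneg _) (((h.erase hi).erase hl) K le_rfl).le)
    (Finset.mem_erase.2 ⟨hij, hj⟩)
  rw [h1] at h3
  have hK : (0 : ℝ) < (K : ℝ) + 2 := by positivity
  nlinarith [mul_pos hK h2]

theorem InCone.prod_le_esymmOn {x : ι → ℝ} {K : ℕ} {S U : Finset ι} (h : InCone x S (K + 1))
    (hU : U ⊆ S) (hc : U.card = K) (hpos : ∀ u ∈ U, 0 < x u) :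
    ∏ u ∈ U, x u ≤ esymmOn x S K := by
  induction K generalizing S U with
  | zero => rw [Finset.card_eq_zero.1 hc]; simp
  | succ K ih =>
    obtain ⟨u, hu⟩ : U.Nonempty := Finset.card_pos.1 (by omega)
    have h1 := ih (h.erase (hU hu)) (Finset.erase_subset_erase u hU)
      (by rw [Finset.card_erase_of_mem hu]; omega)
      fun v hv => hpos v (Finset.mem_of_mem_erase hv)
    rw [← Finset.mul_prod_erase U x hu, esymmOn_erase x (hU hu)]
    have h2 := (h.erase (hU hu)) (K + 1) le_rfl
    nlinarith [mul_le_mul_of_nonneg_left h1 (hpos u hu).le]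

/-- Induction that removes the largest variable `u` of `U`. The prefactor in
`InCone.sq_mul_esymmOn_erase_erase_le` is then at most `2 N x_u`, so `x_u σ_K(S \ {q, u}) ≤ 2 N
σ_{K+1}(S \ q)`: each step costs a factor `2 N`. -/
theorem InCone.prod_top_le {x : ι → ℝ} {N K : ℕ} {S U : Finset ι} {q : ι} (hN : S.card ≤ N)
    (h : InCone x S (K + 1)) (hU : U ⊆ S) (hc : U.card = K) (hpos : ∀ u ∈ U, 0 < x u)
    (htop : ∀ u ∈ U, ∀ v ∈ S, v ∉ U → x v ≤ x u) (hq : q ∈ S) (hqU : q ∉ U) :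
    ∏ u ∈ U, x u ≤ (2 * N : ℝ) ^ K * esymmOn x (S.erase q) K := by
  induction K generalizing S U with
  | zero => rw [Finset.card_eq_zero.1 hc]; simp
  | succ K ih =>
    obtain ⟨u, hu, hmax⟩ := U.exists_max_image x (Finset.card_pos.1 (by omega))
    have hmaxS : ∀ v ∈ S, x v ≤ x u := fun v hv => by
      by_cases hvU : v ∈ U
      · exact hmax v hvU
      · exact htop u hu v hv hvU
    have hqu : q ≠ u := by rintro rfl; exact hqU hu
    have hup := hpos u hu
    have h1 := ih (S := S.erase u) (U := U.erase u) ((Finset.card_erase_le).trans hN)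
      (h.erase (hU hu)) (Finset.erase_subset_erase u hU)
      (by rw [Finset.card_erase_of_mem hu]; omega)
      (fun v hv => hpos v (Finset.mem_of_mem_erase hv))
      (fun v hv w hw hwU => htop v (Finset.mem_of_mem_erase hv) w (Finset.mem_of_mem_erase hw)
        fun hw' => hwU (Finset.mem_erase.2 ⟨Finset.ne_of_mem_erase hw, hw'⟩))
      (Finset.mem_erase.2 ⟨hqu, hq⟩) (fun hq' => hqU (Finset.mem_of_mem_erase hq'))
    rw [Finset.erase_right_comm] at h1
    have h2 := h.sq_mul_esymmOn_erase_erase_le hq (hU hu) hqu.symm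
    have hcard : K + 2 ≤ N := by
      have : (insert q U).card ≤ S.card := Finset.card_le_card (Finset.insert_subset hq hU)
      rw [Finset.card_insert_of_notMem hqU] at this
      omega
    have hs : esymmOn x (S.erase q) 1 ≤ N * x u := by
      rw [esymmOn_one]
      calc _ ≤ (S.erase q).card • x u :=
            Finset.sum_le_card_nsmul _ _ _ fun v hv => hmaxS v (Finset.mem_of_mem_erase hv)
        _ = ((S.erase q).card : ℝ) * x u := nsmul_eq_mul _ _
        _ ≤ _ := by
          gcongr
          exact (Finset.card_erase_le).trans hN
    have hs2 : ((K : ℝ) + 2) * x q ≤ N * x u := by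
      calc ((K : ℝ) + 2) * x q ≤ ((K : ℝ) + 2) * x u := by gcongr; exact hmaxS q hq
        _ ≤ _ := by gcongr; exact_mod_cast hcard
    have he : 0 < esymmOn x (S.erase q) (K + 1) := (h.erase hq) _ le_rfl
    have h3 : x u * (x u * esymmOn x ((S.erase q).erase u) K) ≤
        x u * (2 * N * esymmOn x (S.erase q) (K + 1)) := by
      calc _ = x u ^ 2 * esymmOn x ((S.erase q).erase u) K := by ring
        _ ≤ _ := h2
        _ ≤ (N * x u + N * x u) * esymmOn x (S.erase q) (K + 1) := by gcongr
        _ = _ := by ring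
    have h4 := le_of_mul_le_mul_left h3 hup
    rw [← Finset.mul_prod_erase U x hu]
    calc _ ≤ x u * ((2 * N : ℝ) ^ K * esymmOn x ((S.erase q).erase u) K) := by gcongr
      _ = (2 * N : ℝ) ^ K * (x u * esymmOn x ((S.erase q).erase u) K) := by ring
      _ ≤ (2 * N : ℝ) ^ K * (2 * N * esymmOn x (S.erase q) (K + 1)) := by gcongr
      _ = _ := by ring

theorem exists_top_subset (x : ι → ℝ) (S : Finset ι) {r : ℕ} (hr : r ≤ S.card) :
    ∃ U ⊆ S, U.card = r ∧ ∀ u ∈ U, ∀ v ∈ S, v ∉ U → x v ≤ x u := by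
  induction r with
  | zero => exact ⟨∅, by simp, by simp, by simp⟩
  | succ r ih =>
    obtain ⟨U, hU, hc, htop⟩ := ih (by omega)
    obtain ⟨a, ha, hmax⟩ := (S \ U).exists_max_image x
      (Finset.card_pos.1 (by rw [Finset.card_sdiff_of_subset hU]; omega))
    rw [Finset.mem_sdiff] at ha
    refine ⟨insert a U, Finset.insert_subset ha.1 hU, ?_, ?_⟩
    · rw [Finset.card_insert_of_notMem ha.2, hc]
    · intro u hu v hv hvU
      have hvU' : v ∉ U := fun h => hvU (Finset.mem_insert_of_mem h)
      rcases Finset.mem_insert.1 hu with rfl | hu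
      · exact hmax v (Finset.mem_sdiff.2 ⟨hv, hvU'⟩)
      · exact htop u hu v hv hvU'

/-- Deleting the `K` largest variables lands in `Γ_1`. The remaining ones have positive sum, so
their maximum is positive and none is more negative than `N` times that maximum. -/
theorem InCone.exists_isTopSet {x : ι → ℝ} {N K : ℕ} {S : Finset ι} (hN : S.card ≤ N)
    (h : InCone x S (K + 1)) : ∃ U j, U.card = K ∧ IsTopSet x N S U j := by
  have hcard : K + 1 ≤ S.card := by
    by_contra hlt
    have := h (K + 1) le_rfl
    rw [esymmOn_eq_zero x (by omega)] at this
    exact lt_irrefl _ this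
  obtain ⟨U, hU, hc, htop⟩ := exists_top_subset x S (r := K) (by omega)
  obtain ⟨j, hj, hmax⟩ := (S \ U).exists_max_image x
      (Finset.card_pos.1 (by rw [Finset.card_sdiff_of_subset hU]; omega))
  have h1 : 0 < ∑ v ∈ S \ U, x v := by
    have := InCone.sdiff (k := 1) U hU (by rw [hc, add_comm]; exact h) 1 le_rfl
    rwa [esymmOn_one] at this
  have hsd : ((S \ U).card : ℝ) ≤ N := by
    exact_mod_cast (Finset.card_le_card Finset.sdiff_subset).trans hN
  have hpos : 0 < x j := by
    by_contra hneg
    push Not at hneg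
    exact absurd h1 (not_lt.2 (Finset.sum_nonpos fun v hv => (hmax v hv).trans hneg))
  have hN1 : (1 : ℝ) ≤ N := by exact_mod_cast (by omega : 1 ≤ N)
  rw [Finset.mem_sdiff] at hj
  refine ⟨U, j, hc, hN, hU, hj.1, hj.2, hpos, fun u hu => htop u hu j hj.1 hj.2,
    fun v hv hvU => hmax v (Finset.mem_sdiff.2 ⟨hv, hvU⟩), fun v hv hvU => ?_⟩
  have hv' : v ∈ S \ U := Finset.mem_sdiff.2 ⟨hv, hvU⟩
  rw [abs_le]
  refine ⟨?_, (hmax v hv').trans (by nlinarith)⟩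
  rw [← Finset.add_sum_erase _ _ hv'] at h1
  have h2 : ∑ w ∈ (S \ U).erase v, x w ≤ N * x j := by
    calc _ ≤ ((S \ U).erase v).card • x j :=
          Finset.sum_le_card_nsmul _ _ _ fun w hw => hmax w (Finset.mem_of_mem_erase hw)
      _ = (((S \ U).erase v).card : ℝ) * x j := nsmul_eq_mul _ _
      _ ≤ _ := by
        gcongr
        exact (Finset.card_erase_le).trans (by exact_mod_cast hsd)
  linarith

/-- A monomial that omits some elements of `U ∩ W` has equally many additional factors outside `U`.
Each of these is at most `N x_j`, and `x_j` is at most any omitted factor. There are at most `2^N`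
monomials. -/
theorem IsTopSet.abs_esymmOn_le {x : ι → ℝ} {N : ℕ} {S U : Finset ι} {j : ι}
    (h : IsTopSet x N S U j) {W : Finset ι} (hW : W ⊆ S) {n : ℕ} (hn : (U ∩ W).card ≤ n) :
    |esymmOn x W n| ≤ (2 * N : ℝ) ^ N * ((∏ u ∈ U ∩ W, x u) * x j ^ (n - (U ∩ W).card)) := by
  have hm := h.pos
  have hN1 : (1 : ℝ) ≤ N := by exact_mod_cast h.one_le
  have hP : 0 ≤ ∏ u ∈ U ∩ W, x u :=
    Finset.prod_nonneg fun u hu => (h.pos_of_mem (Finset.mem_inter.1 hu).1).le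
  have hWN : W.card ≤ N := (Finset.card_le_card hW).trans h.card_le
  have key : ∀ T ∈ W.powersetCard n, |∏ i ∈ T, x i| ≤
      (N : ℝ) ^ N * ((∏ u ∈ U ∩ W, x u) * x j ^ (n - (U ∩ W).card)) := by
    intro T hT
    obtain ⟨hTW, hTn⟩ := Finset.mem_powersetCard.1 hT
    have hUT : U ∩ W ∩ T = T ∩ U := by
      ext i; simp only [Finset.mem_inter]; constructor
      · rintro ⟨⟨a, b⟩, c⟩; exact ⟨c, a⟩
      · rintro ⟨a, b⟩; exact ⟨⟨b, hTW a⟩, a⟩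
    have hcard : (T \ U).card = (n - (U ∩ W).card) + ((U ∩ W) \ T).card := by
      have e1 := Finset.card_sdiff_add_card_inter T U
      have e2 := Finset.card_sdiff_add_card_inter (U ∩ W) T
      rw [hUT] at e2
      omega
    have hTU : (T \ U).card ≤ N :=
      ((Finset.card_le_card Finset.sdiff_subset).trans (Finset.card_le_card hTW)).trans hWN
    have h1 : ∏ i ∈ T \ U, |x i| ≤ (N * x j) ^ (T \ U).card := by
      rw [← Finset.prod_const]
      refine Finset.prod_le_prod (fun _ _ => abs_nonneg _) fun v hv => ?_
      obtain ⟨hvT, hvU⟩ := Finset.mem_sdiff.1 hv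
      exact h.abs_le v (hW (hTW hvT)) hvU
    have h2 : x j ^ ((U ∩ W) \ T).card ≤ ∏ u ∈ (U ∩ W) \ T, x u := by
      rw [← Finset.prod_const]
      refine Finset.prod_le_prod (fun _ _ => hm.le) fun u hu => h.le_of_mem u ?_
      exact (Finset.mem_inter.1 (Finset.mem_sdiff.1 hu).1).1
    have h3 : ∏ i ∈ T ∩ U, |x i| = ∏ i ∈ T ∩ U, x i :=
      Finset.prod_congr rfl fun i hi => abs_of_pos (h.pos_of_mem (Finset.mem_inter.1 hi).2)
    have h3' : 0 ≤ ∏ i ∈ T ∩ U, x i :=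
      Finset.prod_nonneg fun i hi => (h.pos_of_mem (Finset.mem_inter.1 hi).2).le
    have h4 : ∏ u ∈ U ∩ W, x u = (∏ u ∈ T ∩ U, x u) * ∏ u ∈ (U ∩ W) \ T, x u := by
      rw [← hUT, Finset.prod_inter_mul_prod_sdiff]
    rw [Finset.abs_prod, ← Finset.prod_inter_mul_prod_sdiff T U, h3, h4]
    calc _ ≤ (∏ i ∈ T ∩ U, x i) * (N * x j) ^ (T \ U).card := by gcongr
      _ = (N : ℝ) ^ (T \ U).card * ((∏ i ∈ T ∩ U, x i) * (x j ^ ((U ∩ W) \ T).card) *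
            x j ^ (n - (U ∩ W).card)) := by rw [mul_pow, hcard, pow_add (x j)]; ring
      _ ≤ (N : ℝ) ^ N * ((∏ i ∈ T ∩ U, x i) * (∏ u ∈ (U ∩ W) \ T, x u) *
            x j ^ (n - (U ∩ W).card)) := by
        gcongr
  have hcard2 : ((W.powersetCard n).card : ℝ) ≤ 2 ^ N := by
    rw [Finset.card_powersetCard]
    exact_mod_cast (Nat.choose_le_two_pow W.card n).trans (Nat.pow_le_pow_right (by norm_num) hWN)
  calc _ ≤ ∑ T ∈ W.powersetCard n, |∏ i ∈ T, x i| := Finset.abs_sum_le_sum_abs _ _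
    _ ≤ (W.powersetCard n).card • ((N : ℝ) ^ N *
          ((∏ u ∈ U ∩ W, x u) * x j ^ (n - (U ∩ W).card))) :=
      Finset.sum_le_card_nsmul _ _ _ key
    _ ≤ 2 ^ N * ((N : ℝ) ^ N * ((∏ u ∈ U ∩ W, x u) * x j ^ (n - (U ∩ W).card))) := by
      rw [nsmul_eq_mul]
      gcongr
    _ = _ := by rw [mul_pow]; ring

/-- Pigeonhole on the scales `τ₀`, `ε τ₀²`, and so on: a variable strictly inside the current gap
lies above every later scale and can be discarded, so at most `r + 1` scales are tried. Thus `η`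
does not depend on `U` or `x`. -/
theorem exists_gap {ε : ℝ} (hε : 0 < ε) (hε1 : ε ≤ 1) (r : ℕ) {τ₀ : ℝ} (hτ₀ : 0 < τ₀)
    (hτ₁ : τ₀ ≤ 1) :
    ∃ η : ℝ, 0 < η ∧ ∀ {ι : Type} (U : Finset ι) (x : ι → ℝ), U.card ≤ r →
      ∃ τ : ℝ, 0 < τ ∧ τ ≤ τ₀ ∧ η ≤ ε * τ ^ 2 ∧ ∀ i ∈ U, τ ≤ x i ∨ x i ≤ ε * τ ^ 2 := by
  induction r generalizing τ₀ with
  | zero =>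
    refine ⟨ε * τ₀ ^ 2, by positivity, fun U x hU => ⟨τ₀, hτ₀, le_rfl, le_rfl, fun i hi => ?_⟩⟩
    rw [Finset.card_eq_zero.1 (Nat.le_zero.1 hU)] at hi
    simp at hi
  | succ r ih =>
    have hle : ε * τ₀ ^ 2 ≤ τ₀ := by nlinarith
    obtain ⟨η, hη, H⟩ := ih (τ₀ := ε * τ₀ ^ 2) (by positivity) (hle.trans hτ₁)
    refine ⟨min η (ε * τ₀ ^ 2), by positivity, fun {ι} U x hU => ?_⟩
    classical
    by_cases hall : ∀ i ∈ U, τ₀ ≤ x i ∨ x i ≤ ε * τ₀ ^ 2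
    · exact ⟨τ₀, hτ₀, le_rfl, min_le_right _ _, hall⟩
    · push Not at hall
      obtain ⟨i, hi, hi1, hi2⟩ := hall
      obtain ⟨τ, hτ, hττ, hητ, hd⟩ := H (U.erase i) x
        (by rw [Finset.card_erase_of_mem hi]; omega)
      refine ⟨τ, hτ, hττ.trans hle, (min_le_left _ _).trans hητ, fun l hl => ?_⟩
      by_cases hli : l = i
      · subst hli; left; linarith
      · exact hd l (Finset.mem_erase.2 ⟨hli, hl⟩)

end Estimates

/-! ### Comparison of `σ_{K+2}` and its derivatives with the top product. -/

section TopSetBounds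

variable {ι : Type*} [DecidableEq ι] {x : ι → ℝ} {N K : ℕ} {S U : Finset ι} {j : ι}

theorem IsTopSet.card_add_one_le (T : IsTopSet x N S U j) : U.card + 1 ≤ N := by
  rw [← Finset.card_insert_of_notMem T.notMem]
  exact (Finset.card_le_card (Finset.insert_subset T.mem T.subset)).trans T.card_le

theorem IsTopSet.pow_le_const (T : IsTopSet x N S U j) (hU : U.card = K + 1) :
    (2 * N : ℝ) ^ (K + 1) ≤ (2 * N : ℝ) ^ N :=
  pow_le_pow_right₀ T.one_le_const (by have := T.card_add_one_le; omega)

theorem IsTopSet.prod_le_of_notMem (T : IsTopSet x N S U j) (h : InCone x S (K + 2))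
    (hU : U.card = K + 1) {q : ι} (hq : q ∈ S) (hqU : q ∉ U) :
    ∏ u ∈ U, x u ≤ (2 * N : ℝ) ^ N * esymmOn x (S.erase q) (K + 1) := by
  refine (h.prod_top_le T.card_le T.subset hU (fun u hu => T.pos_of_mem hu)
    (fun u hu v hv hvU => T.top hu hv hvU) hq hqU).trans ?_
  exact mul_le_mul_of_nonneg_right (T.pow_le_const hU) ((h.erase hq) _ le_rfl).le

theorem IsTopSet.prod_le_of_mem (T : IsTopSet x N S U j) (h : InCone x S (K + 2))
    (hU : U.card = K + 1) (h1 : ∀ i ∈ S, |x i| ≤ 1) {i : ι} (hi : i ∈ U) :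
    x j ^ 2 * ∏ u ∈ U.erase i, x u ≤ (2 * N : ℝ) ^ N * esymmOn x (S.erase i) (K + 1) := by
  have hiS := T.subset hi
  have hji : j ≠ i := by rintro rfl; exact T.notMem hi
  have hF := (h.erase hiS) _ le_rfl
  have e1 := h.sq_mul_esymmOn_erase_erase_le hiS T.mem hji
  have e2 := (h.erase hiS).prod_top_le (U := U.erase i) (q := j)
    ((Finset.card_erase_le).trans T.card_le)
    (Finset.erase_subset_erase i T.subset) (by rw [Finset.card_erase_of_mem hi]; omega)
    (fun u hu => T.pos_of_mem (Finset.mem_of_mem_erase hu))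
    (fun u hu v hv hvU => T.top (Finset.mem_of_mem_erase hu) (Finset.mem_of_mem_erase hv)
      fun hv' => hvU (Finset.mem_erase.2 ⟨Finset.ne_of_mem_erase hv, hv'⟩))
    (Finset.mem_erase.2 ⟨hji, T.mem⟩) (fun hj => T.notMem (Finset.mem_of_mem_erase hj))
  have hK : ((K : ℝ) + 2) ≤ N := by
    have := T.card_add_one_le
    exact_mod_cast (by omega : K + 2 ≤ N)
  have hs : esymmOn x (S.erase i) 1 ≤ N := by
    rw [esymmOn_one]
    calc _ ≤ (S.erase i).card • (1 : ℝ) := Finset.sum_le_card_nsmul _ _ _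
            fun v hv => (_root_.abs_le.1 (h1 v (Finset.mem_of_mem_erase hv))).2
      _ = ((S.erase i).card : ℝ) := by simp
      _ ≤ N := by exact_mod_cast (Finset.card_erase_le).trans T.card_le
  have hs2 : ((K : ℝ) + 2) * x i ≤ N := by
    have := (_root_.abs_le.1 (h1 i hiS)).2
    nlinarith [T.pos_of_mem hi]
  calc x j ^ 2 * ∏ u ∈ U.erase i, x u
      ≤ x j ^ 2 * ((2 * N : ℝ) ^ K * esymmOn x ((S.erase i).erase j) K) := by gcongr
    _ = (2 * N : ℝ) ^ K * (x j ^ 2 * esymmOn x ((S.erase i).erase j) K) := by ring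
    _ ≤ (2 * N : ℝ) ^ K * ((N + N) * esymmOn x (S.erase i) (K + 1)) := by
      refine mul_le_mul_of_nonneg_left (e1.trans ?_) (by positivity)
      gcongr
    _ = (2 * N : ℝ) ^ (K + 1) * esymmOn x (S.erase i) (K + 1) := by ring
    _ ≤ _ := mul_le_mul_of_nonneg_right (T.pow_le_const hU) hF.le

theorem IsTopSet.esymmOn_le (T : IsTopSet x N S U j) (hU : U.card = K + 1) :
    esymmOn x S (K + 2) ≤ (2 * N : ℝ) ^ N * ((∏ u ∈ U, x u) * x j) := by
  have hUS : U ∩ S = U := Finset.inter_eq_left.2 T.subset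
  have := T.abs_esymmOn_le (W := S) subset_rfl (n := K + 2) (by rw [hUS]; omega)
  rw [hUS, hU, show K + 2 - (K + 1) = 1 by omega, pow_one] at this
  exact (le_abs_self _).trans this

/-- If `σ_{K+2}(S \ q) ≤ 0`, the deletion identity suffices. Otherwise `S \ q` is still in
`Γ_{K+2}`, so the product over `U` with `q` replaced by `j` is at most `σ_{K+1}(S \ q)`. -/
theorem IsTopSet.esymmOn_le_of_mem (T : IsTopSet x N S U j) (h : InCone x S (K + 2))
    (hU : U.card = K + 1) {q : ι} (hq : q ∈ U) :
    esymmOn x S (K + 2) ≤ 2 * (2 * N : ℝ) ^ N * (x q * esymmOn x (S.erase q) (K + 1)) := by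
  have hqS := T.subset hq
  have hxq := T.pos_of_mem hq
  have hFq := (h.erase hqS) _ le_rfl
  have hL : (1 : ℝ) ≤ (2 * N : ℝ) ^ N := one_le_pow₀ T.one_le_const
  have hF := esymmOn_erase x hqS (K + 1)
  have hpos : 0 < x q * esymmOn x (S.erase q) (K + 1) := mul_pos hxq hFq
  rcases le_or_gt (esymmOn x (S.erase q) (K + 2)) 0 with hle | hgt
  · nlinarith
  · have hcone : InCone x (S.erase q) (K + 2) := by
      intro i hi
      rcases Nat.lt_or_ge i (K + 2) with hlt | hge
      · exact (h.erase hqS) i (by omega)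
      · rwa [le_antisymm hi hge]
    have hjq : j ≠ q := by rintro rfl; exact T.notMem hq
    have hjU : j ∉ U.erase q := fun hj => T.notMem (Finset.mem_of_mem_erase hj)
    have h1 := hcone.prod_le_esymmOn (U := insert j (U.erase q))
      (Finset.insert_subset (Finset.mem_erase.2 ⟨hjq, T.mem⟩)
        (Finset.erase_subset_erase q T.subset))
      (by rw [Finset.card_insert_of_notMem hjU, Finset.card_erase_of_mem hq]; omega)
      (by
        intro u hu
        rcases Finset.mem_insert.1 hu with rfl | hu
        · exact T.pos
        · exact T.pos_of_mem (Finset.mem_of_mem_erase hu))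
    rw [Finset.prod_insert hjU] at h1
    have h2 := T.esymmOn_le hU
    rw [← Finset.mul_prod_erase U x hq] at h2
    calc _ ≤ _ := h2
      _ = (2 * N : ℝ) ^ N * (x q * (x j * ∏ u ∈ U.erase q, x u)) := by ring
      _ ≤ (2 * N : ℝ) ^ N * (x q * esymmOn x (S.erase q) (K + 1)) := by gcongr
      _ ≤ _ := by nlinarith [mul_pos (zero_lt_one.trans_le hL) hpos]

theorem IsTopSet.abs_esymmOn_erase_le (T : IsTopSet x N S U j) (h : InCone x S (K + 2))
    (hU : U.card = K + 1) (h1 : ∀ i ∈ S, |x i| ≤ 1) {i : ι} (hi : i ∈ U) :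
    |esymmOn x (S.erase i) (K + 3)| ≤
      ((2 * N : ℝ) ^ N) ^ 2 * x j * esymmOn x (S.erase i) (K + 1) := by
  have hUS : U ∩ S.erase i = U.erase i := by
    rw [Finset.inter_erase, Finset.inter_eq_left.2 T.subset]
  have hc : (U.erase i).card = K := by rw [Finset.card_erase_of_mem hi]; omega
  have := T.abs_esymmOn_le (W := S.erase i) (Finset.erase_subset _ _) (n := K + 3)
    (by rw [hUS]; omega)
  rw [hUS, hc, show K + 3 - K = 3 by omega] at this
  have h2 := T.prod_le_of_mem h hU h1 hi
  have hm := T.pos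
  calc _ ≤ _ := this
    _ = (2 * N : ℝ) ^ N * x j * (x j ^ 2 * ∏ u ∈ U.erase i, x u) := by ring
    _ ≤ (2 * N : ℝ) ^ N * x j * ((2 * N : ℝ) ^ N * esymmOn x (S.erase i) (K + 1)) := by gcongr
    _ = _ := by ring

/-- Without `p` the monomials of degree `K + 2` need at least two factors outside `U`, three if `i ∈
U`. After squaring, one surplus `x_j` is traded for `ε x_p²`, which restores the missing `x_p` in
the lower bounds of both derivatives on the right. -/
theorem IsTopSet.sq_esymmOn_erase_erase_le (T : IsTopSet x N S U j) (h : InCone x S (K + 2))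
    (hU : U.card = K + 1) (h1 : ∀ i ∈ S, |x i| ≤ 1) {i₁ p i : ι} (hi₁ : i₁ ∈ U)
    (hx₁ : x i₁ = 1) (hp : p ∈ U) (hi : i ∈ S) (hip : i ≠ p) {ε : ℝ} (hε : 0 ≤ ε)
    (hj : x j ≤ ε * x p ^ 2) :
    esymmOn x ((S.erase p).erase i) (K + 2) ^ 2 ≤
      ((2 * N : ℝ) ^ N) ^ 4 * ε *
        (esymmOn x (S.erase i₁) (K + 1) * esymmOn x (S.erase i) (K + 1)) := by
  have hm := T.pos
  have hxp := T.pos_of_mem hp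
  have hm1 : x j ≤ 1 := (_root_.abs_le.1 (h1 j T.mem)).2
  have hL : (0 : ℝ) < (2 * N : ℝ) ^ N := by have := T.one_le_const; positivity
  set L := (2 * N : ℝ) ^ N
  have hF1 := T.prod_le_of_mem h hU h1 hi₁
  have hP1 : ∏ u ∈ U.erase i₁, x u = ∏ u ∈ U, x u := by
    rw [← Finset.mul_prod_erase U x hi₁, hx₁, one_mul]
  rw [hP1] at hF1
  have hcp : (U.erase p).card = K := by rw [Finset.card_erase_of_mem hp]; omega
  have hW : (S.erase p).erase i ⊆ S := (Finset.erase_subset _ _).trans (Finset.erase_subset _ _)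
  have hUSp : U ∩ S.erase p = U.erase p := by
    rw [Finset.inter_erase, Finset.inter_eq_left.2 T.subset]
  by_cases hiU : i ∈ U
  · have hip' : i ∈ U.erase p := Finset.mem_erase.2 ⟨hip, hiU⟩
    have hUS : U ∩ (S.erase p).erase i = (U.erase p).erase i := by
      rw [Finset.inter_erase, hUSp]
    have hc : ((U.erase p).erase i).card = K - 1 := by
      rw [Finset.card_erase_of_mem hip']; omega
    have hK : 1 ≤ K := by
      have := Finset.card_pos.2 ⟨i, hip'⟩
      omega
    have hE := T.abs_esymmOn_le hW (n := K + 2) (by rw [hUS]; omega)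
    rw [hUS, hc, show K + 2 - (K - 1) = 3 by omega] at hE
    have hFi := T.prod_le_of_mem h hU h1 hiU
    have hxi := T.pos_of_mem hiU
    have hpi : p ∈ U.erase i := Finset.mem_erase.2 ⟨hip.symm, hp⟩
    rw [← Finset.mul_prod_erase U x hiU, ← Finset.mul_prod_erase _ x hpi,
      Finset.erase_right_comm] at hF1
    rw [← Finset.mul_prod_erase _ x hpi, Finset.erase_right_comm] at hFi
    have hP : 0 < ∏ u ∈ (U.erase p).erase i, x u := Finset.prod_pos fun u hu =>
      T.pos_of_mem (Finset.mem_of_mem_erase (Finset.mem_of_mem_erase hu))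
    set P := ∏ u ∈ (U.erase p).erase i, x u
    have hmi : x j ≤ x i := T.le_of_mem i hiU
    calc _ ≤ (L * (P * x j ^ 3)) ^ 2 := sq_le_sq.2 (by
          rwa [abs_of_pos (by positivity : 0 < L * (P * x j ^ 3))])
      _ = L ^ 2 * P ^ 2 * x j ^ 4 * (x j * x j) := by ring
      _ ≤ L ^ 2 * P ^ 2 * x j ^ 4 * (x i * (ε * x p ^ 2)) := by gcongr
      _ = L ^ 2 * ε * ((x j ^ 2 * (x i * (x p * P))) * (x j ^ 2 * (x p * P))) := by ring
      _ ≤ L ^ 2 * ε * ((L * esymmOn x (S.erase i₁) (K + 1)) *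
            (L * esymmOn x (S.erase i) (K + 1))) := by
        gcongr
        exact mul_nonneg hL.le ((h.erase (T.subset hi₁)) _ le_rfl).le
      _ = _ := by ring
  · have hUS : U ∩ (S.erase p).erase i = U.erase p := by
      rw [Finset.inter_erase, hUSp, Finset.erase_eq_of_notMem]
      exact fun hi' => hiU (Finset.mem_of_mem_erase hi')
    have hE := T.abs_esymmOn_le hW (n := K + 2) (by rw [hUS]; omega)
    rw [hUS, hcp, show K + 2 - K = 2 by omega] at hE
    have hFi := T.prod_le_of_notMem h hU hi hiU
    rw [← Finset.mul_prod_erase U x hp] at hFi hF1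
    have hP : 0 < ∏ u ∈ U.erase p, x u := Finset.prod_pos fun u hu =>
      T.pos_of_mem (Finset.mem_of_mem_erase hu)
    set P := ∏ u ∈ U.erase p, x u
    calc _ ≤ (L * (P * x j ^ 2)) ^ 2 := sq_le_sq.2 (by
          rwa [abs_of_pos (by positivity : 0 < L * (P * x j ^ 2))])
      _ = L ^ 2 * P ^ 2 * x j ^ 2 * (x j * x j) := by ring
      _ ≤ L ^ 2 * P ^ 2 * x j ^ 2 * (1 * (ε * x p ^ 2)) := by gcongr
      _ = L ^ 2 * ε * ((x j ^ 2 * (x p * P)) * (x p * P)) := by ring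
      _ ≤ L ^ 2 * ε * ((L * esymmOn x (S.erase i₁) (K + 1)) *
            (L * esymmOn x (S.erase i) (K + 1))) := by
        gcongr
        exact mul_nonneg hL.le ((h.erase (T.subset hi₁)) _ le_rfl).le
      _ = _ := by ring

theorem neg_le_prod {δ : ℝ} (hδ : 0 ≤ δ) (T : Finset ι) (h1 : ∀ i ∈ T, |x i| ≤ 1)
    (h2 : ∀ i ∈ T, -δ ≤ x i) : -δ ≤ ∏ i ∈ T, x i := by
  by_cases hall : ∀ i ∈ T, 0 ≤ x i
  · exact (neg_nonpos.2 hδ).trans (Finset.prod_nonneg hall)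
  · push Not at hall
    obtain ⟨i, hi, hneg⟩ := hall
    refine (neg_le_neg ?_).trans (neg_abs_le _)
    rw [Finset.abs_prod, ← Finset.mul_prod_erase T _ hi]
    have h3 : ∏ l ∈ T.erase i, |x l| ≤ 1 :=
      Finset.prod_le_one (fun _ _ => abs_nonneg _) fun l hl => h1 l (Finset.mem_of_mem_erase hl)
    calc |x i| * ∏ l ∈ T.erase i, |x l| ≤ |x i| * 1 := by gcongr
      _ ≤ δ := by rw [mul_one, abs_of_neg hneg]; linarith [h2 i hi]

/-- Each monomial is at least `-δ`, and the top one is at least `x_j^{K+2}`. Hence `x_j` is small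
when `σ_{K+2}` and `δ` are. -/
theorem IsTopSet.pow_le (T : IsTopSet x N S U j) (hU : U.card = K + 1)
    (h1 : ∀ i ∈ S, |x i| ≤ 1) {δ : ℝ} (hδ : 0 ≤ δ) (h2 : ∀ i ∈ S, -δ ≤ x i) :
    x j ^ (K + 2) ≤ esymmOn x S (K + 2) + 2 ^ N * δ := by
  have hm := T.pos
  have hmem : insert j U ∈ S.powersetCard (K + 2) := Finset.mem_powersetCard.2
    ⟨Finset.insert_subset T.mem T.subset, by rw [Finset.card_insert_of_notMem T.notMem, hU]⟩
  unfold esymmOn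
  rw [← Finset.add_sum_erase _ _ hmem, Finset.prod_insert T.notMem]
  have h3 : x j ^ (K + 1) ≤ ∏ u ∈ U, x u := by
    rw [← hU, ← Finset.prod_const]
    exact Finset.prod_le_prod (fun _ _ => hm.le) fun u hu => T.le_of_mem u hu
  have h4 : ((S.powersetCard (K + 2)).erase (insert j U)).card • (-δ) ≤
      ∑ t ∈ (S.powersetCard (K + 2)).erase (insert j U), ∏ i ∈ t, x i := by
    refine Finset.card_nsmul_le_sum _ _ _ fun t ht => ?_
    have hts := (Finset.mem_powersetCard.1 (Finset.mem_of_mem_erase ht)).1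
    exact neg_le_prod hδ t (fun i hi => h1 i (hts hi)) fun i hi => h2 i (hts hi)
  have h5 : ((((S.powersetCard (K + 2)).erase (insert j U)).card : ℕ) : ℝ) ≤ 2 ^ N := by
    have : (S.powersetCard (K + 2)).card ≤ 2 ^ N := by
      rw [Finset.card_powersetCard]
      exact (Nat.choose_le_two_pow _ _).trans (Nat.pow_le_pow_right (by norm_num) T.card_le)
    exact_mod_cast (Finset.card_erase_le).trans this
  rw [nsmul_eq_mul] at h4
  calc x j ^ (K + 2) = x j * x j ^ (K + 1) := by ring
    _ ≤ x j * ∏ u ∈ U, x u := by gcongr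
    _ ≤ _ := by nlinarith

end TopSetBounds

/-! ### Splitting into large and small variables. -/

section Splitting

/-- The variables split into a group `A` of large ones and a group of `ε`-small ones, with the
bounds on `σ_{K+2}` and its derivatives that such a gap entails near the boundary of the cone. -/
structure IsSplitting {ι : Type*} [DecidableEq ι] (x : ι → ℝ) (S : Finset ι) (K : ℕ)
    (A : Finset ι) (i₁ : ι) (ε : ℝ) : Prop where
  subset : A ⊆ S
  mem : i₁ ∈ A
  card_le : A.card ≤ K + 1
  abs_le : ∀ i ∈ S \ A, |x i| ≤ ε
  le_deriv : ∀ i ∈ S \ A, esymmOn x S (K + 2) ≤ ε ^ 2 * esymmOn x (S.erase i) (K + 1)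
  sq_le : ∀ p ∈ A, ∀ i ∈ S, i ≠ p → esymmOn x ((S.erase p).erase i) (K + 2) ^ 2 ≤
    ε ^ 2 * (esymmOn x (S.erase i₁) (K + 1) * esymmOn x (S.erase i) (K + 1))
  abs_sum_sub_le : |∑ i ∈ S \ A, x i ^ 2 * esymmOn x (S.erase i) (K + 1) -
    (K + 3 - A.card) * (esymmOn x (S.erase i₁) (K + 1) - esymmOn x S (K + 2))| ≤
      ε * esymmOn x (S.erase i₁) (K + 1)

variable {ι : Type*} [DecidableEq ι] {x : ι → ℝ} {K : ℕ} {S A : Finset ι} {i₁ : ι}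

theorem sq_mul_esymmOn_erase_eq (hi₁ : i₁ ∈ S) (hx₁ : x i₁ = 1) {p : ι} (hp : p ∈ S)
    (hne : p ≠ i₁) :
    x p ^ 2 * esymmOn x (S.erase p) (K + 1) = x p * esymmOn x S (K + 2) +
      (esymmOn x (S.erase i₁) (K + 1) - esymmOn x S (K + 2)) +
      (1 - x p) * esymmOn x ((S.erase p).erase i₁) (K + 2) := by
  have e1 := esymmOn_erase x hp (K + 1)
  have e2 := esymmOn_erase x hi₁ (K + 1)
  have e3 := esymmOn_erase x (S := S.erase p) (a := i₁) (Finset.mem_erase.2 ⟨hne.symm, hi₁⟩) (K + 1)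
  have e4 := esymmOn_erase x (S := S.erase i₁) (a := p) (Finset.mem_erase.2 ⟨hne, hp⟩) (K + 1)
  rw [Finset.erase_right_comm] at e4
  rw [hx₁] at e2 e3
  linear_combination (-x p) * e1 + e2 - x p * e3 + e4

/-- With `G` the derivative at `i₁`, the full second moment has leading part `(K + 3)(G - σ)`, and
each element of `A` takes away one `G - σ`; every other term on the right is an error. -/
theorem sum_sdiff_sq_mul_esymmOn_erase (hA : A ⊆ S) (hi₁ : i₁ ∈ A) (hx₁ : x i₁ = 1) :
    ∑ i ∈ S \ A, x i ^ 2 * esymmOn x (S.erase i) (K + 1) =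
      (∑ i ∈ S \ A, x i) * esymmOn x S (K + 2) +
      (K + 3 - A.card) * (esymmOn x (S.erase i₁) (K + 1) - esymmOn x S (K + 2)) -
      (K + 3) * esymmOn x (S.erase i₁) (K + 3) -
      ∑ p ∈ A.erase i₁, (1 - x p) * esymmOn x ((S.erase p).erase i₁) (K + 2) := by
  have e1 := sum_sq_mul_esymmOn_erase x S (K + 1)
  have hiS := hA hi₁
  have e2 := esymmOn_erase x hiS (K + 1)
  have e3 := esymmOn_erase x hiS (K + 2)
  rw [esymmOn_one, ← Finset.sum_sdiff hA, ← Finset.sum_sdiff (f := x) hA,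
    ← Finset.add_sum_erase A _ hi₁, ← Finset.add_sum_erase A x hi₁,
    Finset.sum_congr rfl fun p hp => sq_mul_esymmOn_erase_eq hiS hx₁
      (hA (Finset.mem_of_mem_erase hp)) (Finset.ne_of_mem_erase hp),
    Finset.sum_add_distrib, Finset.sum_add_distrib, ← Finset.sum_mul, Finset.sum_const,
    nsmul_eq_mul, Finset.card_erase_of_mem hi₁, Nat.cast_sub (Finset.card_pos.2 ⟨_, hi₁⟩)] at e1
  rw [hx₁] at e1 e2 e3
  simp only [add_assoc, Nat.reduceAdd] at e1 e2 e3
  push_cast at e1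
  linear_combination e1 - (K + 3) * e3 + (K + 3) * e2

theorem exists_gap_constants {N L ε : ℝ} (hN : 1 ≤ N) (hLN : 2 * N ≤ L) (hε : 0 < ε)
    (hε1 : ε ≤ 1) :
    ∃ ε₁ θ : ℝ, 0 < ε₁ ∧ 0 < θ ∧ θ < 1 ∧ ε₁ ≤ ε ∧ N * ε₁ = ε / 4 ∧ L ^ 4 * θ ≤ ε₁ ^ 2 ∧
      2 * (L ^ 2 * θ) ≤ ε₁ ^ 2 ∧ 2 * L * θ ≤ ε₁ ^ 2 ∧ N * θ ≤ ε₁ ∧ ε₁ ^ 2 ≤ ε₁ := by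
  have hL1 : 1 ≤ L := by linarith
  -- A sum of at most `N` errors of size `ε₁` stays below `ε / 4`.
  obtain ⟨ε₁, hε₁⟩ : ∃ ε₁ : ℝ, ε₁ = ε / (4 * N) := ⟨_, rfl⟩
  have hε₁pos : 0 < ε₁ := by rw [hε₁]; positivity
  have hε₁N : N * ε₁ = ε / 4 := by rw [hε₁]; field_simp
  have hε₁ε : ε₁ ≤ ε := by nlinarith
  obtain ⟨θ, hθ⟩ : ∃ θ : ℝ, θ = ε₁ ^ 2 / (2 * L ^ 4) := ⟨_, rfl⟩
  have hθpos : 0 < θ := by rw [hθ]; positivity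
  have hθL : 2 * (L ^ 4 * θ) = ε₁ ^ 2 := by rw [hθ]; field_simp
  have hL2 : L ^ 2 ≤ L ^ 4 := pow_le_pow_right₀ hL1 (by norm_num)
  have hL4 : L ≤ L ^ 4 := le_self_pow₀ hL1 (by norm_num)
  have hsq : ε₁ ^ 2 ≤ ε₁ := by nlinarith
  have h2 := mul_le_mul_of_nonneg_right hL2 hθpos.le
  have h4 := mul_le_mul_of_nonneg_right hL4 hθpos.le
  have h5 := mul_le_mul_of_nonneg_right hLN hθpos.le
  have h6 := mul_le_mul_of_nonneg_right hN hθpos.le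
  refine ⟨ε₁, θ, hε₁pos, hθpos, ?_, hε₁ε, hε₁N, ?_, ?_, ?_, ?_, hsq⟩ <;> nlinarith

theorem IsTopSet.isSplitting {N : ℕ} {U : Finset ι} {j : ι} {ε ε₁ θ τ : ℝ}
    (T : IsTopSet x N S U j) (h : InCone x S (K + 2)) (hU : U.card = K + 1)
    (habs : ∀ i ∈ S, |x i| ≤ 1) (hx₁ : x i₁ = 1) (hi₁U : i₁ ∈ U)
    (hε₁pos : 0 < ε₁) (hθpos : 0 < θ) (hε : ε ≤ 1) (hε₁ε : ε₁ ≤ ε) (hNε : N * ε₁ = ε / 4)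
    (hθ4 : ((2 * N : ℝ) ^ N) ^ 4 * θ ≤ ε₁ ^ 2) (hθ2 : 2 * (((2 * N : ℝ) ^ N) ^ 2 * θ) ≤ ε₁ ^ 2)
    (hθ1 : 2 * (2 * N : ℝ) ^ N * θ ≤ ε₁ ^ 2) (hθN : N * θ ≤ ε₁) (hsq : ε₁ ^ 2 ≤ ε₁)
    (hτ : 0 < τ) (hτ1 : τ ≤ 1) (hjτ : x j ≤ θ * τ ^ 2)
    (hgap : ∀ i ∈ U, τ ≤ x i ∨ x i ≤ θ * τ ^ 2) :
    IsSplitting x S K (U.filter fun i => τ ≤ x i) i₁ ε := by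
  have hm := T.pos
  have hN1 : (1 : ℝ) ≤ N := by exact_mod_cast T.one_le
  have hτθ : θ * τ ^ 2 ≤ θ := mul_le_of_le_one_right hθpos.le (pow_le_one₀ hτ.le hτ1)
  obtain ⟨A, hA⟩ : ∃ A, A = U.filter (fun i => τ ≤ x i) := ⟨_, rfl⟩
  rw [← hA]
  have hAU : A ⊆ U := hA ▸ Finset.filter_subset _ _
  have hAS : A ⊆ S := hAU.trans T.subset
  have hi₁ := T.subset hi₁U
  have hi₁A : i₁ ∈ A := hA ▸ Finset.mem_filter.2 ⟨hi₁U, by rw [hx₁]; exact hτ1⟩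
  have hF0 : 0 < esymmOn x S (K + 2) := h _ le_rfl
  have hd : ∀ i ∈ S, 0 < esymmOn x (S.erase i) (K + 1) := fun i hi => (h.erase hi) _ le_rfl
  have hG : 0 < esymmOn x (S.erase i₁) (K + 1) := hd i₁ hi₁
  have hjA : ∀ p ∈ A, x j ≤ θ * x p ^ 2 := by
    intro p hp
    have h1 := (Finset.mem_filter.1 (hA ▸ hp)).2
    exact hjτ.trans (by gcongr)
  have hmθ : x j ≤ θ := hjτ.trans hτθ
  have hUA : ∀ i ∈ U, i ∉ A → x i ≤ θ := fun i hiU hiA =>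
    ((hgap i hiU).resolve_left fun h' => hiA (hA ▸ Finset.mem_filter.2 ⟨hiU, h'⟩)).trans hτθ
  have hsmall : ∀ i ∈ S \ A, |x i| ≤ ε₁ := by
    intro i hi
    obtain ⟨hiS, hiA⟩ := Finset.mem_sdiff.1 hi
    by_cases hiU : i ∈ U
    · rw [abs_of_pos (T.pos_of_mem hiU)]
      nlinarith [hUA i hiU hiA]
    · exact (T.abs_le i hiS hiU).trans (by nlinarith)
  have hL0 : (0 : ℝ) ≤ (2 * N : ℝ) ^ N := by positivity
  have hE : ∀ p ∈ A, ∀ i ∈ S, i ≠ p → esymmOn x ((S.erase p).erase i) (K + 2) ^ 2 ≤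
      ε₁ ^ 2 * (esymmOn x (S.erase i₁) (K + 1) * esymmOn x (S.erase i) (K + 1)) := by
    intro p hp i hi hip
    exact (T.sq_esymmOn_erase_erase_le h hU habs hi₁U hx₁ (hAU hp) hi hip hθpos.le
      (hjA p hp)).trans (mul_le_mul_of_nonneg_right hθ4 (mul_pos hG (hd i hi)).le)
  have hdF : ∀ i ∈ S \ A, esymmOn x S (K + 2) ≤ ε₁ ^ 2 * esymmOn x (S.erase i) (K + 1) := by
    intro i hi
    obtain ⟨hiS, hiA⟩ := Finset.mem_sdiff.1 hi
    have hFi := hd i hiS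
    by_cases hiU : i ∈ U
    · have h1 := T.esymmOn_le_of_mem h hU hiU
      have h2 := mul_le_mul_of_nonneg_right (hUA i hiU hiA) hFi.le
      have h3 := mul_le_mul_of_nonneg_right hθ1 hFi.le
      have h4 := mul_le_mul_of_nonneg_left h2 (by positivity : (0 : ℝ) ≤ 2 * (2 * N : ℝ) ^ N)
      linarith
    · have h1 := T.esymmOn_le hU
      have h2 := T.prod_le_of_notMem h hU hiS hiU
      have hL2 : ((2 * N : ℝ) ^ N) ^ 2 * θ ≤ ε₁ ^ 2 := by
        have : 0 ≤ ((2 * N : ℝ) ^ N) ^ 2 * θ := by positivity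
        linarith
      generalize (2 * N : ℝ) ^ N = L at *
      calc _ ≤ _ := h1
        _ ≤ L * ((L * esymmOn x (S.erase i) (K + 1)) * θ) := by gcongr
        _ = (L ^ 2 * θ) * esymmOn x (S.erase i) (K + 1) := by ring
        _ ≤ _ := by gcongr
  have hcard : A.card ≤ K + 1 := (Finset.card_le_card hAU).trans hU.le
  have hKN : (K : ℝ) + 3 ≤ 2 * N := by
    have := T.card_add_one_le
    exact_mod_cast (by omega : K + 3 ≤ 2 * N)
  have hcA : ((A.card : ℕ) : ℝ) ≤ K + 1 := by exact_mod_cast hcard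
  -- `hs`, `he` and `hr` control the three errors of `sum_sdiff_sq_mul_esymmOn_erase`. The first
  -- multiplies `σ ≤ 2 G`, so the total is `(2 + 1 + 1) ε / 4` times `G`.
  have hs : |∑ i ∈ S \ A, x i| ≤ ε / 4 := by
    rw [← hNε]
    calc _ ≤ ∑ i ∈ S \ A, |x i| := Finset.abs_sum_le_sum_abs _ _
      _ ≤ (S \ A).card • ε₁ := Finset.sum_le_card_nsmul _ _ _ hsmall
      _ ≤ _ := by
        rw [nsmul_eq_mul]
        gcongr
        exact (Finset.card_le_card Finset.sdiff_subset).trans T.card_le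
  have he : |((K : ℝ) + 3) * esymmOn x (S.erase i₁) (K + 3)| ≤
      ε / 4 * esymmOn x (S.erase i₁) (K + 1) := by
    have h1 := T.abs_esymmOn_erase_le h hU habs hi₁U
    rw [abs_mul, abs_of_pos (by positivity), ← hNε]
    calc _ ≤ 2 * N * (((2 * N : ℝ) ^ N) ^ 2 * x j * esymmOn x (S.erase i₁) (K + 1)) :=
          mul_le_mul hKN h1 (abs_nonneg _) (by positivity)
      _ ≤ 2 * N * (((2 * N : ℝ) ^ N) ^ 2 * θ * esymmOn x (S.erase i₁) (K + 1)) := by gcongr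
      _ = N * (2 * (((2 * N : ℝ) ^ N) ^ 2 * θ)) * esymmOn x (S.erase i₁) (K + 1) := by ring
      _ ≤ N * ε₁ * esymmOn x (S.erase i₁) (K + 1) :=
        mul_le_mul_of_nonneg_right (mul_le_mul_of_nonneg_left (hθ2.trans hsq) (by positivity))
          hG.le
  have hr : |∑ p ∈ A.erase i₁, (1 - x p) * esymmOn x ((S.erase p).erase i₁) (K + 2)| ≤
      ε / 4 * esymmOn x (S.erase i₁) (K + 1) := by
    rw [← hNε]
    calc _ ≤ ∑ p ∈ A.erase i₁, |(1 - x p) * esymmOn x ((S.erase p).erase i₁) (K + 2)| :=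
          Finset.abs_sum_le_sum_abs _ _
      _ ≤ (A.erase i₁).card • (ε₁ * esymmOn x (S.erase i₁) (K + 1)) := by
        refine Finset.sum_le_card_nsmul _ _ _ fun p hp => ?_
        have hpA := Finset.mem_of_mem_erase hp
        have h1 := hE p hpA i₁ hi₁ (Finset.ne_of_mem_erase hp).symm
        have h2 : |esymmOn x ((S.erase p).erase i₁) (K + 2)| ≤
            ε₁ * esymmOn x (S.erase i₁) (K + 1) :=
          abs_le_of_sq_le_sq (by rw [mul_pow]; linarith) (by positivity)
        have hp0 := T.pos_of_mem (hAU hpA)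
        have hp1 := (_root_.abs_le.1 (habs p (hAS hpA))).2
        rw [abs_mul, abs_of_nonneg (by linarith : 0 ≤ 1 - x p)]
        calc _ ≤ 1 * (ε₁ * esymmOn x (S.erase i₁) (K + 1)) := by gcongr; linarith
          _ = _ := one_mul _
      _ ≤ _ := by
        rw [nsmul_eq_mul, ← mul_assoc]
        gcongr
        exact ((Finset.card_le_card ((Finset.erase_subset _ _).trans hAS))).trans T.card_le
  refine ⟨hAS, hi₁A, hcard, fun i hi => (hsmall i hi).trans hε₁ε, fun i hi => ?_,
    fun p hp i hi hip => ?_, ?_⟩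
  · have hFi := hd i (Finset.mem_sdiff.1 hi).1
    exact (hdF i hi).trans (by gcongr)
  · have hFi := hd i hi
    exact (hE p hp i hi hip).trans (by gcongr)
  · have hV := sum_sdiff_sq_mul_esymmOn_erase (K := K) hAS hi₁A hx₁
    have hV0 : 0 ≤ ∑ i ∈ S \ A, x i ^ 2 * esymmOn x (S.erase i) (K + 1) :=
      Finset.sum_nonneg fun i hi => mul_nonneg (sq_nonneg _)
        (hd i (Finset.mem_sdiff.1 hi).1).le
    have hsF : |(∑ i ∈ S \ A, x i) * esymmOn x S (K + 2)| ≤ ε / 4 * esymmOn x S (K + 2) := by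
      rw [abs_mul, abs_of_pos hF0]; gcongr
    have ha : (2 : ℝ) ≤ (K : ℝ) + 3 - A.card := by linarith
    rw [hV] at hV0 ⊢
    generalize ((K : ℝ) + 3 - A.card) = a at *
    generalize (∑ i ∈ S \ A, x i) * esymmOn x S (K + 2) = b at *
    generalize ((K : ℝ) + 3) * esymmOn x (S.erase i₁) (K + 3) = e at *
    generalize ∑ p ∈ A.erase i₁, (1 - x p) * esymmOn x ((S.erase p).erase i₁) (K + 2) = r at *
    generalize esymmOn x S (K + 2) = F at *
    generalize esymmOn x (S.erase i₁) (K + 1) = G at *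
    clear * - hV0 hsF he hr ha hF0 hG hε₁ε hε₁pos hε
    rw [_root_.abs_le] at hsF he hr
    -- If `F` exceeded `2 G`, the nonnegative sum over `S \ A` would be negative, because `a ≥ 2`.
    have hFG : F ≤ 2 * G := by
      by_contra hlt
      push Not at hlt
      have h1 : a * (G - F) ≤ 2 * (G - F) := mul_le_mul_of_nonpos_right ha (by linarith)
      have h2 : ε / 4 * G ≤ 1 / 4 * G := by gcongr
      have h3 : ε / 4 * F ≤ 1 / 4 * F := by gcongr
      linarith
    have h4 : ε / 4 * F ≤ ε / 4 * (2 * G) := by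
      have : 0 < ε := by linarith
      gcongr
    rw [_root_.abs_le]
    constructor <;> linarith

end Splitting

/-! ### Existence of a splitting near the boundary of the cone. -/

theorem exists_isSplitting (N K : ℕ) {ε : ℝ} (hε : 0 < ε) (hε1 : ε ≤ 1) :
    ∃ η : ℝ, 0 < η ∧ ∀ {ι : Type} [DecidableEq ι] (x : ι → ℝ) (S : Finset ι) (i₁ : ι),
      S.card ≤ N → i₁ ∈ S → InCone x S (K + 2) → x i₁ = 1 → (∀ i ∈ S, |x i| ≤ 1) →
      (∀ i ∈ S, -η ≤ x i) → esymmOn x S (K + 2) ≤ η →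
      ∃ A, IsSplitting x S K A i₁ ε := by
  rcases Nat.eq_zero_or_pos N with rfl | hNpos
  · refine ⟨1, one_pos, fun x S i₁ hS hi₁ => ?_⟩
    rw [Finset.card_eq_zero.1 (Nat.le_zero.1 hS)] at hi₁
    simp at hi₁
  have hN1 : (1 : ℝ) ≤ N := by exact_mod_cast hNpos
  have hLN : 2 * (N : ℝ) ≤ (2 * N : ℝ) ^ N := le_self_pow₀ (by linarith) hNpos.ne'
  obtain ⟨ε₁, θ, hε₁, hθ, hθ1, hεε, hNε, h4, h2, h1, hNθ, hsq⟩ :=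
    exists_gap_constants hN1 hLN hε hε1
  obtain ⟨η, hη, H⟩ := exists_gap hθ hθ1.le (K + 1) one_pos le_rfl
  -- With this bound on both `σ_{K+2}` and the negative parts, `IsTopSet.pow_le` gives `x_j ≤ η`,
  -- below every gap that can occur.
  refine ⟨η ^ (K + 2) / (1 + 2 ^ N), by positivity, ?_⟩
  intro ι _ x S i₁ hS hi₁ h hx₁ habs hlow hF
  obtain ⟨U, j, hU, T⟩ := InCone.exists_isTopSet hS h
  have hmη : x j ≤ η := by
    have h1 := T.pow_le hU habs (by positivity) hlow
    have h2 : η ^ (K + 2) / (1 + 2 ^ N) * (1 + 2 ^ N) = η ^ (K + 2) :=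
      div_mul_cancel₀ _ (by positivity)
    exact le_of_pow_le_pow_left₀ (n := K + 2) (by omega) hη.le (by linarith)
  obtain ⟨τ, hτ, hτ1, hητ, hgap⟩ := H U x hU.le
  have hτθ : θ * τ ^ 2 ≤ θ := mul_le_of_le_one_right hθ.le (pow_le_one₀ hτ.le hτ1)
  -- Otherwise `1 = x i₁ ≤ x j ≤ θ < 1`.
  have hi₁U : i₁ ∈ U := by
    by_contra hn
    have := T.le_of_notMem i₁ hi₁ hn
    linarith
  exact ⟨_, T.isSplitting h hU habs hx₁ hi₁U hε₁ hθ hε1 hεε hNε h4 h2 h1 hNθ hsq hτ hτ1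
    (hmη.trans hητ) hgap⟩

/-! ### Log-concavity in the test direction. -/

section TestVector

variable {ι : Type*} [DecidableEq ι] {x : ι → ℝ} {K : ℕ} {S A : Finset ι} {i₁ : ι}

theorem sum_hessian_symm (x ξ χ : ι → ℝ) (S : Finset ι) (K : ℕ) :
    ∑ p ∈ S, ∑ q ∈ S.erase p, χ p * ξ q * esymmOn x ((S.erase p).erase q) K =
      ∑ p ∈ S, ∑ q ∈ S.erase p, ξ p * χ q * esymmOn x ((S.erase p).erase q) K := by
  rw [Finset.sum_comm' (s' := fun q => S.erase q) (t' := S)]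
  · refine Finset.sum_congr rfl fun p _ => Finset.sum_congr rfl fun q _ => ?_
    rw [Finset.erase_right_comm]
    ring
  · intro p q
    simp only [Finset.mem_erase]
    constructor
    · rintro ⟨a, b, c⟩; exact ⟨⟨b.symm, a⟩, c⟩
    · rintro ⟨⟨a, b⟩, c⟩; exact ⟨b, a.symm, c⟩

/-- Log-concavity at `ξ - tχ`, expanded. Of the two copies of `(Dσ(ξ))² / σ`, one pays for
log-concavity and the other completes the square with `t (C - z) Dσ(ξ)`. The products `ρ_i ξ_i` with
`i ≠ i₁` go into the weighted sum of squares by Young's inequality with parameter `β`; only `ρ_{i₁}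
ξ_{i₁}` survives. -/
theorem InCone.hessian_lower_bound (h : InCone x S (K + 2)) (hi₁ : i₁ ∈ S) {χ ρ : ι → ℝ}
    {C z β : ℝ} (hβ : 0 < β)
    (hrow : ∀ i ∈ S, ∑ q ∈ S.erase i, χ q * esymmOn x ((S.erase i).erase q) K =
      C * esymmOn x (S.erase i) (K + 1) + ρ i)
    (hd : ∑ i ∈ S, χ i * esymmOn x (S.erase i) (K + 1) = z * esymmOn x S (K + 2))
    (ξ : ι → ℝ) (t : ℝ) :
    -2 * t * (ρ i₁ * ξ i₁) - t ^ 2 * (esymmOn x S (K + 2) * ((C - z) ^ 2 - z * (C - z)) -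
        ∑ i ∈ S, ρ i * χ i + β * ∑ i ∈ S.erase i₁, ρ i ^ 2 / esymmOn x (S.erase i) (K + 1)) ≤
      -(∑ p ∈ S, ∑ q ∈ S.erase p, ξ p * ξ q * esymmOn x ((S.erase p).erase q) K) +
        2 * ((∑ i ∈ S, ξ i * esymmOn x (S.erase i) (K + 1)) ^ 2 / esymmOn x S (K + 2)) +
        1 / β * ∑ i ∈ S.erase i₁, esymmOn x (S.erase i) (K + 1) * ξ i ^ 2 := by
  have hF : 0 < esymmOn x S (K + 2) := h _ le_rfl
  have hlc := h.mul_hessian_le_sq (fun i => ξ i - t * χ i)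
  have hmix : ∑ p ∈ S, ∑ q ∈ S.erase p, ξ p * χ q * esymmOn x ((S.erase p).erase q) K =
      C * (∑ i ∈ S, ξ i * esymmOn x (S.erase i) (K + 1)) + ∑ i ∈ S, ρ i * ξ i := by
    rw [Finset.mul_sum, ← Finset.sum_add_distrib]
    refine Finset.sum_congr rfl fun p hp => ?_
    rw [show C * (ξ p * esymmOn x (S.erase p) (K + 1)) + ρ p * ξ p =
      ξ p * (C * esymmOn x (S.erase p) (K + 1) + ρ p) by ring, ← hrow p hp, Finset.mul_sum]
    exact Finset.sum_congr rfl fun q _ => by ring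
  have hχχ : ∑ p ∈ S, ∑ q ∈ S.erase p, χ p * χ q * esymmOn x ((S.erase p).erase q) K =
      C * (z * esymmOn x S (K + 2)) + ∑ i ∈ S, ρ i * χ i := by
    rw [← hd, Finset.mul_sum, ← Finset.sum_add_distrib]
    refine Finset.sum_congr rfl fun p hp => ?_
    rw [show C * (χ p * esymmOn x (S.erase p) (K + 1)) + ρ p * χ p =
      χ p * (C * esymmOn x (S.erase p) (K + 1) + ρ p) by ring, ← hrow p hp, Finset.mul_sum]
    exact Finset.sum_congr rfl fun q _ => by ring
  have hQ : ∑ p ∈ S, ∑ q ∈ S.erase p, (ξ p - t * χ p) * (ξ q - t * χ q) *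
        esymmOn x ((S.erase p).erase q) K =
      ∑ p ∈ S, ∑ q ∈ S.erase p, ξ p * ξ q * esymmOn x ((S.erase p).erase q) K
      - t * ∑ p ∈ S, ∑ q ∈ S.erase p, ξ p * χ q * esymmOn x ((S.erase p).erase q) K
      - t * ∑ p ∈ S, ∑ q ∈ S.erase p, χ p * ξ q * esymmOn x ((S.erase p).erase q) K
      + t ^ 2 * ∑ p ∈ S, ∑ q ∈ S.erase p, χ p * χ q * esymmOn x ((S.erase p).erase q) K := by
    simp only [Finset.mul_sum, ← Finset.sum_sub_distrib, ← Finset.sum_add_distrib]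
    exact Finset.sum_congr rfl fun p _ => Finset.sum_congr rfl fun q _ => by ring
  have hD : ∑ i ∈ S, (ξ i - t * χ i) * esymmOn x (S.erase i) (K + 1) =
      ∑ i ∈ S, ξ i * esymmOn x (S.erase i) (K + 1) - t * (z * esymmOn x S (K + 2)) := by
    rw [← hd]
    simp only [Finset.mul_sum, ← Finset.sum_sub_distrib]
    exact Finset.sum_congr rfl fun p _ => by ring
  rw [hQ, hD, sum_hessian_symm x ξ χ S K, hmix, hχχ] at hlc
  have hsq : ∑ i ∈ S.erase i₁, (2 * t * (ρ i * ξ i)) ≤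
      1 / β * ∑ i ∈ S.erase i₁, esymmOn x (S.erase i) (K + 1) * ξ i ^ 2 +
      t ^ 2 * (β * ∑ i ∈ S.erase i₁, ρ i ^ 2 / esymmOn x (S.erase i) (K + 1)) := by
    simp only [Finset.mul_sum, ← Finset.sum_add_distrib]
    refine Finset.sum_le_sum fun i hi => ?_
    have hFi : 0 < esymmOn x (S.erase i) (K + 1) :=
      (h.erase (Finset.mem_of_mem_erase hi)) _ le_rfl
    have hid : 1 / β * (esymmOn x (S.erase i) (K + 1) * ξ i ^ 2) +
        t ^ 2 * (β * (ρ i ^ 2 / esymmOn x (S.erase i) (K + 1))) - 2 * t * (ρ i * ξ i) =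
        (esymmOn x (S.erase i) (K + 1) * ξ i - t * β * ρ i) ^ 2 /
          (β * esymmOn x (S.erase i) (K + 1)) := by
      field_simp
      ring
    have : 0 ≤ (esymmOn x (S.erase i) (K + 1) * ξ i - t * β * ρ i) ^ 2 /
          (β * esymmOn x (S.erase i) (K + 1)) := by positivity
    linarith
  rw [← Finset.mul_sum] at hsq
  have hsplit : ∑ i ∈ S, ρ i * ξ i = ρ i₁ * ξ i₁ + ∑ i ∈ S.erase i₁, ρ i * ξ i :=
    (Finset.add_sum_erase _ _ hi₁).symm
  rw [hsplit] at hlc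
  generalize ∑ i ∈ S.erase i₁, ρ i * ξ i = r at *
  generalize ∑ i ∈ S, ρ i * χ i = ρχ at *
  generalize ∑ i ∈ S, ξ i * esymmOn x (S.erase i) (K + 1) = d at *
  generalize ∑ p ∈ S, ∑ q ∈ S.erase p, ξ p * ξ q * esymmOn x ((S.erase p).erase q) K = Q at *
  generalize 1 / β * ∑ i ∈ S.erase i₁, esymmOn x (S.erase i) (K + 1) * ξ i ^ 2 = q₁ at *
  generalize β * ∑ i ∈ S.erase i₁, ρ i ^ 2 / esymmOn x (S.erase i) (K + 1) = q₂ at *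
  generalize ρ i₁ * ξ i₁ = l at *
  generalize esymmOn x S (K + 2) = F at *
  clear * - hF hlc hsq
  have h1 : Q - 2 * t * (C * d + (l + r)) + t ^ 2 * (C * (z * F) + ρχ) ≤
      d ^ 2 / F - 2 * t * z * d + t ^ 2 * z ^ 2 * F := by
    have e : d ^ 2 / F - 2 * t * z * d + t ^ 2 * z ^ 2 * F = (d - t * (z * F)) ^ 2 / F := by
      field_simp
      ring
    rw [e, le_div_iff₀ hF]
    linarith
  have h2 : 0 ≤ d ^ 2 / F + 2 * t * (C - z) * d + t ^ 2 * (C - z) ^ 2 * F := by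
    have e : d ^ 2 / F + 2 * t * (C - z) * d + t ^ 2 * (C - z) ^ 2 * F =
      (d + t * ((C - z) * F)) ^ 2 / F := by
      field_simp
      ring
    rw [e]
    positivity
  have h3 : 0 ≤ d ^ 2 / F - 2 * t * (C - z) * d + t ^ 2 * (C - z) ^ 2 * F := by
    have e : d ^ 2 / F - 2 * t * (C - z) * d + t ^ 2 * (C - z) ^ 2 * F =
      (d - t * ((C - z) * F)) ^ 2 / F := by
      field_simp
      ring
    rw [e]
    positivity
  linarith

/-- The direction in which log-concavity of `σ_{K+2}` is exploited. -/
def testVector (x : ι → ℝ) (A : Finset ι) (i₁ : ι) (c z w : ℝ) (q : ι) : ℝ :=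
  (if q = i₁ then 1 + c else 0) - z * x q - w * (if q ∈ A then 0 else x q ^ 2)

/-- Reduces Hessian entries at large `p` to `σ` and its gradient, with `σ_{K+2}(S \ {p, i})` as the
only error. -/
theorem hessian_mul_sq {i p : ι} (hi : i ∈ S) (hp : p ∈ S) (hpi : p ≠ i) :
    x p ^ 2 * esymmOn x ((S.erase i).erase p) K =
      esymmOn x (S.erase i) (K + 1) * (x p + x i) - esymmOn x S (K + 2) +
        esymmOn x ((S.erase p).erase i) (K + 2) := by
  have e1 := esymmOn_erase x hi (K + 1)
  have e2 := esymmOn_erase x (S := S.erase i) (a := p) (Finset.mem_erase.2 ⟨hpi, hp⟩) (K + 1)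
  have e3 := esymmOn_erase x (S := S.erase i) (a := p) (Finset.mem_erase.2 ⟨hpi, hp⟩) K
  rw [Finset.erase_right_comm (a := p)]
  linear_combination e1 + e2 - x p * e3

theorem sum_sq_mul_hessian {i : ι} (hi : i ∈ S) :
    ∑ q ∈ S.erase i, x q ^ 2 * esymmOn x ((S.erase i).erase q) K =
      (∑ q ∈ S, x q - x i) * esymmOn x (S.erase i) (K + 1) -
        (K + 2) * (esymmOn x S (K + 2) - x i * esymmOn x (S.erase i) (K + 1)) := by
  have e1 := esymmOn_erase x hi (K + 1)
  rw [sum_sq_mul_esymmOn_erase, esymmOn_one, ← Finset.add_sum_erase S x hi]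
  linear_combination (K + 2 : ℝ) * e1

theorem sum_testVector_mul_hessian (hA : A ⊆ S) (hi₁ : i₁ ∈ S) (hx₁ : x i₁ = 1) (c z w : ℝ)
    {i : ι} (hi : i ∈ S) :
    ∑ q ∈ S.erase i, testVector x A i₁ c z w q * esymmOn x ((S.erase i).erase q) K =
      (if i = i₁ then 0 else (1 + c) * (esymmOn x (S.erase i) (K + 1) * (1 + x i) -
        esymmOn x S (K + 2) + esymmOn x ((S.erase i₁).erase i) (K + 2))) -
      z * ((K + 1) * esymmOn x (S.erase i) (K + 1)) -
      w * ((∑ q ∈ S, x q - x i) * esymmOn x (S.erase i) (K + 1) -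
        (K + 2) * (esymmOn x S (K + 2) - x i * esymmOn x (S.erase i) (K + 1)) -
        ((∑ p ∈ A.erase i, x p) * esymmOn x (S.erase i) (K + 1) +
          (A.erase i).card * (x i * esymmOn x (S.erase i) (K + 1) - esymmOn x S (K + 2)) +
          ∑ p ∈ A.erase i, esymmOn x ((S.erase p).erase i) (K + 2))) := by
  have h1 : ∑ q ∈ S.erase i, (if q = i₁ then 1 + c else 0) * esymmOn x ((S.erase i).erase q) K =
      (if i = i₁ then 0 else (1 + c) * (esymmOn x (S.erase i) (K + 1) * (1 + x i) -
        esymmOn x S (K + 2) + esymmOn x ((S.erase i₁).erase i) (K + 2))) := by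
    simp only [ite_mul, zero_mul, Finset.sum_ite_eq']
    by_cases hii : i = i₁
    · simp [hii]
    · rw [if_pos (Finset.mem_erase.2 ⟨fun h => hii h.symm, hi₁⟩), if_neg hii]
      have := hessian_mul_sq (K := K) (x := x) hi hi₁ fun h => hii h.symm
      rw [hx₁] at this
      rw [← this]
      ring
  have h2 := sum_mul_esymmOn_erase x (S.erase i) K
  have h3 := sum_sq_mul_hessian (x := x) (K := K) hi
  have h4 : ∑ q ∈ A.erase i, x q ^ 2 * esymmOn x ((S.erase i).erase q) K =
      (∑ p ∈ A.erase i, x p) * esymmOn x (S.erase i) (K + 1) +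
          (A.erase i).card * (x i * esymmOn x (S.erase i) (K + 1) - esymmOn x S (K + 2)) +
          ∑ p ∈ A.erase i, esymmOn x ((S.erase p).erase i) (K + 2) := by
    rw [Finset.sum_congr rfl fun q hq => hessian_mul_sq hi (hA (Finset.mem_of_mem_erase hq))
        (Finset.ne_of_mem_erase hq), Finset.sum_mul, ← nsmul_eq_mul, ← Finset.sum_const,
      ← Finset.sum_add_distrib, ← Finset.sum_add_distrib]
    exact Finset.sum_congr rfl fun p _ => by ring
  have h5 : ∑ q ∈ S.erase i, (if q ∈ A then 0 else x q ^ 2) * esymmOn x ((S.erase i).erase q) K =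
      ∑ q ∈ S.erase i, x q ^ 2 * esymmOn x ((S.erase i).erase q) K -
        ∑ q ∈ A.erase i, x q ^ 2 * esymmOn x ((S.erase i).erase q) K := by
    have e : A.erase i = (S.erase i).filter (· ∈ A) := by
      ext q
      simp only [Finset.mem_erase, Finset.mem_filter]
      exact ⟨fun ⟨a, b⟩ => ⟨⟨a, hA b⟩, b⟩, fun ⟨⟨a, _⟩, b⟩ => ⟨a, b⟩⟩
    rw [e, Finset.sum_filter, ← Finset.sum_sub_distrib]
    refine Finset.sum_congr rfl fun q _ => ?_
    by_cases hq : q ∈ A <;> simp [hq]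
  rw [← h1, ← h2, ← h4, ← h3, ← h5]
  simp only [Finset.mul_sum, ← Finset.sum_sub_distrib]
  exact Finset.sum_congr rfl fun q _ => by unfold testVector; ring

theorem sum_testVector_mul_deriv (hi₁ : i₁ ∈ S) (c z w : ℝ) :
    ∑ i ∈ S, testVector x A i₁ c z w i * esymmOn x (S.erase i) (K + 1) =
      (1 + c) * esymmOn x (S.erase i₁) (K + 1) - z * ((K + 2) * esymmOn x S (K + 2)) -
        w * ∑ i ∈ S \ A, x i ^ 2 * esymmOn x (S.erase i) (K + 1) := by
  have h2 := sum_mul_esymmOn_erase x S (K + 1)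
  push_cast at h2
  have h1 : ∑ i ∈ S, (if i = i₁ then 1 + c else 0) * esymmOn x (S.erase i) (K + 1) =
      (1 + c) * esymmOn x (S.erase i₁) (K + 1) := by
    simp [ite_mul, Finset.sum_ite_eq', hi₁]
  have h5 : ∑ q ∈ S, (if q ∈ A then 0 else x q ^ 2) * esymmOn x (S.erase q) (K + 1) =
      ∑ i ∈ S \ A, x i ^ 2 * esymmOn x (S.erase i) (K + 1) := by
    rw [Finset.sdiff_eq_filter, Finset.sum_filter]
    refine Finset.sum_congr rfl fun q _ => ?_
    by_cases hq : q ∈ A <;> simp [hq]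
  rw [← h1, ← h5, show ((K : ℝ) + 2) = K + 1 + 1 by ring, ← h2]
  simp only [Finset.mul_sum, ← Finset.sum_sub_distrib]
  exact Finset.sum_congr rfl fun q _ => by unfold testVector; ring

end TestVector

/-! ### Error bounds for the Hessian rows under a splitting. -/

section SplittingBounds

variable {ι : Type*} [DecidableEq ι] {x : ι → ℝ} {K : ℕ} {S A : Finset ι} {i₁ : ι} {ε : ℝ}

theorem InCone.deriv_le_deriv (h : InCone x S (K + 2)) {i : ι} (hi₁ : i₁ ∈ S) (hi : i ∈ S)
    (hle : x i ≤ x i₁) : esymmOn x (S.erase i₁) (K + 1) ≤ esymmOn x (S.erase i) (K + 1) := by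
  rcases eq_or_ne i i₁ with rfl | hne
  · exact le_rfl
  have e1 := esymmOn_erase x (S := S.erase i) (a := i₁) (Finset.mem_erase.2 ⟨hne.symm, hi₁⟩) K
  have e2 := esymmOn_erase x (S := S.erase i₁) (a := i) (Finset.mem_erase.2 ⟨hne, hi⟩) K
  have hH := ((h.erase hi).erase (Finset.mem_erase.2 ⟨hne.symm, hi₁⟩)) K le_rfl
  rw [Finset.erase_right_comm] at e2
  nlinarith

theorem IsSplitting.two_le (P : IsSplitting x S K A i₁ ε) : (2 : ℝ) ≤ (K : ℝ) + 3 - A.card := by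
  have : (A.card : ℝ) ≤ K + 1 := by exact_mod_cast P.card_le
  linarith

theorem IsSplitting.neg_le (P : IsSplitting x S K A i₁ ε) (h : InCone x S (K + 2)) (hε : 0 < ε) :
    -(ε * esymmOn x (S.erase i₁) (K + 1)) ≤
      esymmOn x (S.erase i₁) (K + 1) - esymmOn x S (K + 2) := by
  have hV0 : 0 ≤ ∑ i ∈ S \ A, x i ^ 2 * esymmOn x (S.erase i) (K + 1) :=
    Finset.sum_nonneg fun i hi => mul_nonneg (sq_nonneg _)
      ((h.erase (Finset.mem_sdiff.1 hi).1) _ le_rfl).le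
  have hG : 0 < esymmOn x (S.erase i₁) (K + 1) := (h.erase (P.subset P.mem)) _ le_rfl
  have h1 := (_root_.abs_le.1 P.abs_sum_sub_le).2
  have h2 := P.two_le
  have h3 := mul_pos hε hG
  by_contra hlt
  push Not at hlt
  nlinarith

theorem IsSplitting.le_two_mul (P : IsSplitting x S K A i₁ ε) (h : InCone x S (K + 2))
    (hε : 0 < ε) (hε1 : ε ≤ 1) :
    esymmOn x S (K + 2) ≤ 2 * esymmOn x (S.erase i₁) (K + 1) := by
  have hG : 0 < esymmOn x (S.erase i₁) (K + 1) := (h.erase (P.subset P.mem)) _ le_rfl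
  have := P.neg_le h hε
  nlinarith

theorem IsSplitting.sq_mul_deriv_le (P : IsSplitting x S K A i₁ ε) (h : InCone x S (K + 2))
    (hε : 0 < ε) (hε1 : ε ≤ 1) (hx₁ : x i₁ = 1) (habs : ∀ i ∈ S, |x i| ≤ 1) {i : ι}
    (hi : i ∈ S) :
    x i ^ 2 * esymmOn x (S.erase i) (K + 1) ≤ (K + 5) * esymmOn x (S.erase i₁) (K + 1) := by
  have hi₁ := P.subset P.mem
  have hG : 0 < esymmOn x (S.erase i₁) (K + 1) := (h.erase hi₁) _ le_rfl
  have hF : 0 < esymmOn x S (K + 2) := h _ le_rfl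
  have hF2 := P.le_two_mul h hε hε1
  have hK : (0 : ℝ) ≤ K := Nat.cast_nonneg K
  have hεG := mul_le_mul_of_nonneg_right hε1 hG.le
  by_cases hiA : i ∈ A
  · rcases eq_or_ne i i₁ with rfl | hne
    · rw [hx₁]; nlinarith
    · rw [sq_mul_esymmOn_erase_eq hi₁ hx₁ hi hne]
      have h1 := P.sq_le i hiA i₁ hi₁ hne.symm
      have h2 : |esymmOn x ((S.erase i).erase i₁) (K + 2)| ≤
          ε * esymmOn x (S.erase i₁) (K + 1) :=
        abs_le_of_sq_le_sq (by rw [mul_pow]; linarith) (by positivity)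
      obtain ⟨h3, h4⟩ := _root_.abs_le.1 (habs i hi)
      have h5 : (1 - x i) * esymmOn x ((S.erase i).erase i₁) (K + 2) ≤
          2 * esymmOn x (S.erase i₁) (K + 1) := by
        calc _ ≤ |(1 - x i) * esymmOn x ((S.erase i).erase i₁) (K + 2)| := le_abs_self _
          _ = (1 - x i) * |esymmOn x ((S.erase i).erase i₁) (K + 2)| := by
            rw [abs_mul, abs_of_nonneg (by linarith)]
          _ ≤ 2 * (1 * esymmOn x (S.erase i₁) (K + 1)) := by
            refine mul_le_mul (by linarith) (h2.trans hεG) (abs_nonneg _) (by norm_num)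
          _ = _ := by ring
      have h6 : x i * esymmOn x S (K + 2) ≤ 1 * esymmOn x S (K + 2) := by gcongr
      nlinarith
  · have h1 : x i ^ 2 * esymmOn x (S.erase i) (K + 1) ≤
        ∑ i ∈ S \ A, x i ^ 2 * esymmOn x (S.erase i) (K + 1) :=
      Finset.single_le_sum (f := fun i => x i ^ 2 * esymmOn x (S.erase i) (K + 1))
        (fun i hi => mul_nonneg (sq_nonneg _)
          ((h.erase (Finset.mem_sdiff.1 hi).1) _ le_rfl).le) (Finset.mem_sdiff.2 ⟨hi, hiA⟩)
    have h2 := (_root_.abs_le.1 P.abs_sum_sub_le).2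
    have h3 := P.two_le
    have h4 : ((K : ℝ) + 3 - A.card) *
        (esymmOn x (S.erase i₁) (K + 1) - esymmOn x S (K + 2)) ≤
        ((K : ℝ) + 3) * esymmOn x (S.erase i₁) (K + 1) := by
      have hA : (0 : ℝ) ≤ A.card := Nat.cast_nonneg _
      calc _ ≤ ((K : ℝ) + 3 - A.card) * esymmOn x (S.erase i₁) (K + 1) := by
            gcongr; linarith
        _ ≤ _ := by gcongr; linarith
    linarith

/-- The error terms in the rows of the Hessian applied to the test vector. -/
def rowError (x : ι → ℝ) (S : Finset ι) (K : ℕ) (A : Finset ι) (i₁ : ι) (c w : ℝ) (i : ι) : ℝ :=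
  c * (x i * esymmOn x (S.erase i) (K + 1) - esymmOn x S (K + 2)) +
    (1 + c) * esymmOn x ((S.erase i₁).erase i) (K + 2) +
    w * ∑ p ∈ A.erase i, esymmOn x ((S.erase p).erase i) (K + 2) -
    (if i ∈ A then 0 else w * esymmOn x S (K + 2))

/-- The deviation of the Hessian applied to the test vector from a multiple of the gradient. -/
def rowDefect (x : ι → ℝ) (S : Finset ι) (K : ℕ) (A : Finset ι) (i₁ : ι) (c w : ℝ) (i : ι) : ℝ :=
  if i = i₁ then -((1 + c) * esymmOn x (S.erase i₁) (K + 1) +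
      (esymmOn x (S.erase i₁) (K + 1) - esymmOn x S (K + 2)) -
      w * ∑ p ∈ A.erase i₁, esymmOn x ((S.erase p).erase i₁) (K + 2))
  else (if i ∈ A then 0 else 2 * w * x i * esymmOn x (S.erase i) (K + 1)) +
    rowError x S K A i₁ c w i

/-- The normalisation of `w` cancels the term `x_i σ_i - σ` that `e_{i₁}` produces in row `i ≠ i₁`.
The Hessian has zero diagonal, so row `i₁` has nothing to cancel; the common multiple of the
gradient overshoots there, and the defect is `-(2 G - σ)` to leading order. -/
theorem sum_testVector_mul_hessian_eq (hA : A ⊆ S) (hi₁ : i₁ ∈ A) (hx₁ : x i₁ = 1) {c z w : ℝ}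
    (hw : w * ((K : ℝ) + 3 - A.card) = 1) {i : ι} (hi : i ∈ S) :
    ∑ q ∈ S.erase i, testVector x A i₁ c z w q * esymmOn x ((S.erase i).erase q) K =
      (1 + c - (K + 1) * z - w * ∑ q ∈ S \ A, x q) * esymmOn x (S.erase i) (K + 1) +
        rowDefect x S K A i₁ c w i := by
  rw [sum_testVector_mul_hessian hA (hA hi₁) hx₁ c z w hi, ← Finset.sum_sdiff hA]
  unfold rowDefect
  by_cases hii : i = i₁
  · subst hii
    rw [if_pos rfl, if_pos rfl, ← Finset.add_sum_erase A x hi₁, Finset.card_erase_of_mem hi₁,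
      Nat.cast_sub (Finset.card_pos.2 ⟨_, hi₁⟩), hx₁]
    push_cast
    linear_combination
      (esymmOn x S (K + 2) - esymmOn x (S.erase i) (K + 1)) * hw
  · rw [if_neg hii, if_neg hii]
    unfold rowError
    by_cases hiA : i ∈ A
    · rw [if_pos hiA, if_pos hiA, ← Finset.add_sum_erase A x hiA, Finset.card_erase_of_mem hiA,
        Nat.cast_sub (Finset.card_pos.2 ⟨_, hiA⟩)]
      push_cast
      linear_combination
        (esymmOn x S (K + 2) - x i * esymmOn x (S.erase i) (K + 1)) * hw
    · rw [if_neg hiA, if_neg hiA, Finset.erase_eq_of_notMem hiA]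
      linear_combination
        (esymmOn x S (K + 2) - x i * esymmOn x (S.erase i) (K + 1)) * hw

theorem IsSplitting.sq_rowError_le (P : IsSplitting x S K A i₁ ε) (h : InCone x S (K + 2))
    (hε : 0 < ε) (hε1 : ε ≤ 1) (hx₁ : x i₁ = 1) (habs : ∀ i ∈ S, |x i| ≤ 1) {c w : ℝ}
    (hc : |c| ≤ ε) (hw0 : 0 ≤ w) (hw1 : w ≤ 1) {i : ι} (hi : i ∈ S) (hne : i ≠ i₁) :
    rowError x S K A i₁ c w i ^ 2 ≤ (2 * K + 12) ^ 2 * ε ^ 2 *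
      (esymmOn x (S.erase i₁) (K + 1) * esymmOn x (S.erase i) (K + 1)) := by
  have hi₁ := P.subset P.mem
  have hK : (0 : ℝ) ≤ K := Nat.cast_nonneg K
  have hG : 0 < esymmOn x (S.erase i₁) (K + 1) := (h.erase hi₁) _ le_rfl
  have hFi : 0 < esymmOn x (S.erase i) (K + 1) := (h.erase hi) _ le_rfl
  have hF : 0 < esymmOn x S (K + 2) := h _ le_rfl
  have hGF : esymmOn x (S.erase i₁) (K + 1) ≤ esymmOn x (S.erase i) (K + 1) :=
    h.deriv_le_deriv hi₁ hi (by rw [hx₁]; exact (_root_.abs_le.1 (habs i hi)).2)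
  have hF2 := P.le_two_mul h hε hε1
  have hv := P.sq_mul_deriv_le h hε hε1 hx₁ habs hi
  have hE1 := P.sq_le i₁ P.mem i hi hne
  have hE : ∀ p ∈ A.erase i, esymmOn x ((S.erase p).erase i) (K + 2) ^ 2 ≤ ε ^ 2 *
      (esymmOn x (S.erase i₁) (K + 1) * esymmOn x (S.erase i) (K + 1)) := fun p hp =>
    P.sq_le p (Finset.mem_of_mem_erase hp) i hi (Finset.ne_of_mem_erase hp).symm
  have hdF : i ∉ A → esymmOn x S (K + 2) ≤ ε ^ 2 * esymmOn x (S.erase i) (K + 1) := fun hiA =>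
    P.le_deriv i (Finset.mem_sdiff.2 ⟨hi, hiA⟩)
  have hcard : ((A.erase i).card : ℝ) ≤ K + 1 := by
    exact_mod_cast (Finset.card_erase_le).trans P.card_le
  unfold rowError
  generalize esymmOn x (S.erase i₁) (K + 1) = G at *
  generalize esymmOn x (S.erase i) (K + 1) = Fi at *
  generalize esymmOn x S (K + 2) = F at *
  -- Every piece of the row error is a multiple of `ε` times the geometric mean `b` of the two
  -- derivatives.
  obtain ⟨b, hb0, hb⟩ : ∃ b : ℝ, 0 ≤ b ∧ b ^ 2 = G * Fi :=
    ⟨√(G * Fi), Real.sqrt_nonneg _, Real.sq_sqrt (by positivity)⟩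
  rw [← hb] at hE1 hE ⊢
  have hεb : 0 ≤ ε * b := by positivity
  have hGb : G ≤ b := le_of_sq_le_sq (by nlinarith) hb0
  have t1 : |x i * Fi| ≤ (K + 5) * b := by
    refine abs_le_of_sq_le_sq ?_ (by positivity)
    calc (x i * Fi) ^ 2 = x i ^ 2 * Fi * Fi := by ring
      _ ≤ (K + 5) * G * Fi := by gcongr
      _ = (K + 5) * b ^ 2 := by rw [hb]; ring
      _ ≤ ((K + 5) * b) ^ 2 := by nlinarith [sq_nonneg b]
  have t2 : |c * (x i * Fi - F)| ≤ ε * ((K + 5) * b + 2 * b) := by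
    rw [abs_mul]
    gcongr
    refine (abs_sub _ _).trans ?_
    rw [abs_of_pos hF]
    linarith
  have t3 : |(1 + c) * esymmOn x ((S.erase i₁).erase i) (K + 2)| ≤ 2 * (ε * b) := by
    rw [abs_mul]
    refine mul_le_mul ?_ (abs_le_of_sq_le_sq (by rw [mul_pow]; exact hE1) hεb) (abs_nonneg _)
      (by norm_num)
    refine (abs_add_le _ _).trans ?_
    rw [abs_one]
    linarith
  have t4 : |w * ∑ p ∈ A.erase i, esymmOn x ((S.erase p).erase i) (K + 2)| ≤
      1 * ((K + 1) * (ε * b)) := by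
    rw [abs_mul, abs_of_nonneg hw0]
    refine mul_le_mul hw1 ?_ (abs_nonneg _) (by norm_num)
    calc _ ≤ ∑ p ∈ A.erase i, |esymmOn x ((S.erase p).erase i) (K + 2)| :=
          Finset.abs_sum_le_sum_abs _ _
      _ ≤ (A.erase i).card • (ε * b) := Finset.sum_le_card_nsmul _ _ _ fun p hp =>
          abs_le_of_sq_le_sq (by rw [mul_pow]; exact hE p hp) hεb
      _ ≤ _ := by rw [nsmul_eq_mul]; gcongr
  have t5 : |(if i ∈ A then 0 else w * F)| ≤ 2 * (ε * b) := by
    by_cases hiA : i ∈ A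
    · rw [if_pos hiA, abs_zero]; positivity
    · rw [if_neg hiA, abs_mul, abs_of_nonneg hw0, abs_of_pos hF]
      have h1 : F ^ 2 ≤ (2 * (ε * b)) ^ 2 := by
        calc F ^ 2 = F * F := by ring
          _ ≤ (2 * G) * (ε ^ 2 * Fi) := by gcongr; exact hdF hiA
          _ = 2 * ε ^ 2 * b ^ 2 := by rw [hb]; ring
          _ ≤ _ := by nlinarith [sq_nonneg (ε * b)]
      have h2 : F ≤ 2 * (ε * b) := le_of_sq_le_sq h1 (by positivity)
      nlinarith
  have hsum := (abs_sub (c * (x i * Fi - F) + (1 + c) * esymmOn x ((S.erase i₁).erase i) (K + 2) +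
    w * ∑ p ∈ A.erase i, esymmOn x ((S.erase p).erase i) (K + 2)) (if i ∈ A then 0 else w * F)).trans
    (add_le_add_left ((abs_add_le _ _).trans (add_le_add_left (abs_add_le _ _) _)) _)
  have : (2 * (K : ℝ) + 12) ^ 2 * ε ^ 2 * b ^ 2 = ((2 * K + 12) * (ε * b)) ^ 2 := by ring
  rw [this]
  refine sq_le_sq.2 (hsum.trans ?_)
  rw [abs_of_nonneg (by positivity : 0 ≤ (2 * (K : ℝ) + 12) * (ε * b))]
  linarith

end SplittingBounds

/-! ### Scalar inequalities. -/

section RealInequalities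

theorem abs_mul_le_of_sq_le {Fi G X r M₁ M₂ ε : ℝ} (hG : 0 ≤ G) (hε : 0 ≤ ε)
    (hM₁ : 1 ≤ M₁) (hM : M₂ ≤ M₁) (hv : X ^ 2 * Fi ≤ M₂ * G)
    (hr : r ^ 2 ≤ M₁ ^ 2 * ε ^ 2 * (G * Fi)) : |r * X| ≤ M₁ ^ 2 * ε * G := by
  refine abs_le_of_sq_le_sq ?_ (by positivity)
  calc (r * X) ^ 2 = r ^ 2 * X ^ 2 := by ring
    _ ≤ M₁ ^ 2 * ε ^ 2 * (G * Fi) * X ^ 2 := by gcongr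
    _ = M₁ ^ 2 * ε ^ 2 * G * (X ^ 2 * Fi) := by ring
    _ ≤ M₁ ^ 2 * ε ^ 2 * G * (M₂ * G) := by gcongr
    _ ≤ M₁ ^ 2 * ε ^ 2 * G * (M₁ ^ 2 * G) := by gcongr; nlinarith
    _ = _ := by ring

theorem sq_div_le_of_sq_le {Fi G r M ε : ℝ} (hFi : 0 < Fi) (hG : 0 ≤ G) (hε : 0 ≤ ε) (hε1 : ε ≤ 1)
    (hr : r ^ 2 ≤ M ^ 2 * ε ^ 2 * (G * Fi)) : r ^ 2 / Fi ≤ M ^ 2 * ε * G := by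
  rw [div_le_iff₀ hFi]
  have : M ^ 2 * ε ^ 2 * (G * Fi) ≤ M ^ 2 * ε * (G * Fi) := by
    have : ε ^ 2 ≤ ε := by nlinarith
    gcongr
  linarith

theorem large_index_bound {Fi G X r z β M₁ M₂ ε : ℝ} (hFi : 0 < Fi) (hG : 0 ≤ G) (hε : 0 ≤ ε)
    (hε1 : ε ≤ 1) (hz0 : 0 ≤ z) (hz1 : z ≤ 1) (hβ : β ≤ 1 / 2 + ε) (hM₁ : 1 ≤ M₁)
    (hM : M₂ ≤ M₁) (hv : X ^ 2 * Fi ≤ M₂ * G) (hr : r ^ 2 ≤ M₁ ^ 2 * ε ^ 2 * (G * Fi)) :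
    r * (z * X) + β * (r ^ 2 / Fi) ≤ 20 * (M₁ ^ 2 * ε * G) := by
  have h1 := abs_mul_le_of_sq_le hG hε hM₁ hM hv hr
  have h2 := sq_div_le_of_sq_le hFi hG hε hε1 hr
  have hB : 0 ≤ M₁ ^ 2 * ε * G := by positivity
  have h3 : z * (r * X) ≤ 1 * (M₁ ^ 2 * ε * G) := by
    calc z * (r * X) ≤ z * |r * X| := by gcongr; exact le_abs_self _
      _ ≤ _ := by gcongr
  have h4 : β * (r ^ 2 / Fi) ≤ 2 * (M₁ ^ 2 * ε * G) := by
    gcongr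
    linarith
  linarith

/-- The main part is `2 w z X² Fi` from the pairing with `z X`, plus `4 β w² X² Fi`, about `2 w² X²
Fi`, from Young's inequality. Every other term contains `r`, `X³` or `β - 1/2`. -/
theorem small_index_bound {Fi G X r z w β M₁ M₂ ε : ℝ} (hFi : 0 < Fi) (hG : 0 ≤ G) (hε : 0 ≤ ε)
    (hε1 : ε ≤ 1) (hz0 : 0 ≤ z) (hz1 : z ≤ 1) (hw0 : 0 ≤ w) (hw1 : w ≤ 1)
    (hβ0 : 0 ≤ β) (hβ : β ≤ 1 / 2 + ε) (hM₁ : 1 ≤ M₁) (hM : M₂ ≤ M₁) (hX : |X| ≤ ε)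
    (hv : X ^ 2 * Fi ≤ M₂ * G) (hr : r ^ 2 ≤ M₁ ^ 2 * ε ^ 2 * (G * Fi)) :
    (2 * w * X * Fi + r) * (z * X + w * X ^ 2) + β * ((2 * w * X * Fi + r) ^ 2 / Fi) ≤
      (2 * z + 2 * w) * w * (X ^ 2 * Fi) + 20 * (M₁ ^ 2 * ε * G) := by
  have h1 := abs_mul_le_of_sq_le hG hε hM₁ hM hv hr
  have h2 := sq_div_le_of_sq_le hFi hG hε hε1 hr
  have hB : 0 ≤ M₁ ^ 2 * ε * G := by positivity
  have hv0 : 0 ≤ X ^ 2 * Fi := by positivity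
  have hvB : ε * (X ^ 2 * Fi) ≤ M₁ ^ 2 * ε * G := by
    calc ε * (X ^ 2 * Fi) ≤ ε * (M₂ * G) := by gcongr
      _ ≤ ε * (M₁ ^ 2 * G) := by gcongr; nlinarith
      _ = _ := by ring
  have e : (2 * w * X * Fi + r) * (z * X + w * X ^ 2) + β * ((2 * w * X * Fi + r) ^ 2 / Fi) =
      2 * w * z * (X ^ 2 * Fi) + 2 * w ^ 2 * X * (X ^ 2 * Fi) + (z + w * X) * (r * X) +
      β * (4 * w ^ 2) * (X ^ 2 * Fi) + β * (4 * w) * (r * X) + β * (r ^ 2 / Fi) := by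
    field_simp
    ring
  rw [e]
  obtain ⟨hX1, hX2⟩ := _root_.abs_le.1 hX
  have hw2 : w ^ 2 ≤ 1 := by nlinarith
  have t1 : 2 * w ^ 2 * X * (X ^ 2 * Fi) ≤ 2 * (M₁ ^ 2 * ε * G) := by
    calc 2 * w ^ 2 * X * (X ^ 2 * Fi) ≤ 2 * w ^ 2 * ε * (X ^ 2 * Fi) := by gcongr
      _ = 2 * w ^ 2 * (ε * (X ^ 2 * Fi)) := by ring
      _ ≤ 2 * 1 * (M₁ ^ 2 * ε * G) := by gcongr
      _ = _ := by ring
  have t2 : (z + w * X) * (r * X) ≤ 2 * (M₁ ^ 2 * ε * G) := by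
    calc (z + w * X) * (r * X) ≤ |z + w * X| * |r * X| := by rw [← abs_mul]; exact le_abs_self _
      _ ≤ 2 * (M₁ ^ 2 * ε * G) := by
        gcongr
        refine (abs_add_le _ _).trans ?_
        rw [abs_of_nonneg hz0, abs_mul, abs_of_nonneg hw0]
        have : w * |X| ≤ 1 * 1 := by gcongr; linarith
        linarith
  have t3 : β * (4 * w ^ 2) * (X ^ 2 * Fi) ≤ 2 * w ^ 2 * (X ^ 2 * Fi) +
      4 * (M₁ ^ 2 * ε * G) := by
    calc β * (4 * w ^ 2) * (X ^ 2 * Fi) ≤ (1 / 2 + ε) * (4 * w ^ 2) * (X ^ 2 * Fi) := by gcongr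
      _ = 2 * w ^ 2 * (X ^ 2 * Fi) + 4 * w ^ 2 * (ε * (X ^ 2 * Fi)) := by ring
      _ ≤ 2 * w ^ 2 * (X ^ 2 * Fi) + 4 * 1 * (M₁ ^ 2 * ε * G) := by gcongr
      _ = _ := by ring
  have t4 : β * (4 * w) * (r * X) ≤ 6 * (M₁ ^ 2 * ε * G) := by
    calc β * (4 * w) * (r * X) ≤ β * (4 * w) * |r * X| := by gcongr; exact le_abs_self _
      _ ≤ 3 / 2 * (4 * 1) * (M₁ ^ 2 * ε * G) := by
        gcongr
        linarith
      _ = _ := by ring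
  have t5 : β * (r ^ 2 / Fi) ≤ 2 * (M₁ ^ 2 * ε * G) := by
    gcongr
    linarith
  nlinarith

/-- The margin `(u - z/2)² + z - z²/4` is at least `11 z / 12`. The errors cost at most `5 μ ≤ z /
20`, and `γ` costs at most `(3 + μ) z / 11`. -/
theorem normalized_quadratic_bound {u R z γ μ : ℝ} (hμ : 0 ≤ μ) (hz : 0 < z) (hz3 : z ≤ 1 / 3)
    (hμz : 100 * μ ≤ z) (hγ : 0 ≤ γ) (hγz : 11 * γ ≤ z) (hu : -μ ≤ u) (hu1 : u ≤ 1)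
    (hR : 1 + u - μ ≤ R) :
    0 < (1 - z) + (2 + z) * u + μ ∧
      (1 + γ) * ((1 - z) + (2 + z) * u + μ) ≤ R ^ 2 := by
  constructor
  · nlinarith
  have h1 : (1 + u - μ) ^ 2 ≤ R ^ 2 := by
    have : 0 ≤ 1 + u - μ := by linarith
    gcongr
  have h2 : γ * ((1 - z) + (2 + z) * u + μ) ≤ γ * (3 + μ) := by
    gcongr
    nlinarith
  have h3 : γ * (3 + μ) ≤ z / 11 * (3 + μ) := by
    gcongr
    linarith
  nlinarith [sq_nonneg (u - z / 2), mul_nonneg hμ (by linarith : 0 ≤ 1 - u)]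

theorem quadratic_bound {G g R D z γ μ : ℝ} (hG : 0 < G) (hμ : 0 ≤ μ) (hz : 0 < z)
    (hz3 : z ≤ 1 / 3) (hμz : 100 * μ ≤ z) (hγ : 0 ≤ γ) (hγz : 11 * γ ≤ z) (hg : -(μ * G) ≤ g)
    (hg1 : g ≤ G) (hR : G + g - μ * G ≤ R) (hD : D = G * (1 - z) + (2 + z) * g + μ * G) :
    0 < D ∧ (1 + γ) * G * D ≤ R ^ 2 := by
  obtain ⟨h1, h2⟩ := normalized_quadratic_bound (u := g / G) (R := R / G) hμ hz hz3 hμz hγ hγz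
    (by rw [le_div_iff₀ hG]; linarith) (by rw [div_le_one hG]; exact hg1)
    (by rw [le_div_iff₀ hG]; field_simp; linarith)
  have e : D = G * ((1 - z) + (2 + z) * (g / G) + μ) := by rw [hD]; field_simp
  refine ⟨by rw [e]; positivity, ?_⟩
  calc (1 + γ) * G * D = G ^ 2 * ((1 + γ) * ((1 - z) + (2 + z) * (g / G) + μ)) := by rw [e]; ring
    _ ≤ G ^ 2 * (R / G) ^ 2 := by gcongr
    _ = R ^ 2 := by field_simp

theorem small_parameter_bounds {K N ε : ℝ} (hK : 0 ≤ K) (hN : 0 ≤ N) (hε : 0 < ε)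
    (hεN : 100 * (K + 3) * (100 * (N + 1) * (2 * K + 12) ^ 2 * ε) ≤ 1) :
    ε ≤ 1 ∧ (K + 2) * ε ≤ 1 ∧ (N + 1) * ε ≤ 1 ∧
      20 * N * (2 * K + 12) ^ 2 * ε + 4 * (N + 1) * ε + 2 * (K + 2) * ε + 10 * ε ≤
        100 * (N + 1) * (2 * K + 12) ^ 2 * ε := by
  have hM : 2 * K + 12 ≤ (2 * K + 12) ^ 2 := by nlinarith
  have h0 : 0 ≤ 100 * (N + 1) * (2 * K + 12) ^ 2 * ε := by positivity
  have h1 : 100 * (N + 1) * (2 * K + 12) ^ 2 * ε ≤ 1 := by nlinarith [mul_nonneg hK h0]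
  have h2 : (N + 1) * (2 * K + 12) * ε ≤ (N + 1) * (2 * K + 12) ^ 2 * ε := by gcongr
  have h3 : 0 ≤ N * ε := by positivity
  have h4 : 0 ≤ K * ε := by positivity
  have h5 : 0 ≤ N * K * ε := by positivity
  have h6 : 0 ≤ (2 * K + 12) ^ 2 * ε := by positivity
  refine ⟨?_, ?_, ?_, ?_⟩ <;> linarith

/-- With `g = G - F`, the term carrying `F` is an error, `R (1 + c - z)` contributes `(1 - z)(G +
g)`, and the remaining indices contribute `(2 z + 2 w) g`; `μ G` collects the errors. -/
theorem exists_denominator_bound {K N ε z w c s V G F R e r₁ r₂ γ : ℝ} (hK : 0 ≤ K)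
    (hN : 0 ≤ N) (hε : 0 < ε)
    (hεN : 100 * (K + 3) * (100 * (N + 1) * (2 * K + 12) ^ 2 * ε) ≤ 1) (hγ0 : 0 ≤ γ)
    (hγ : 11 * (K + 3) * γ ≤ 1) (hG : 0 < G) (hF : 0 < F) (hzK : z * (K + 3) = 1) (hw0 : 0 < w)
    (hw2 : w ≤ 1 / 2) (hc : |c| ≤ ε) (hs : |s| ≤ N * ε)
    (hwVg : |w * V - (G - F)| ≤ ε * G) (hgl : -(ε * G) ≤ G - F) (hF2 : F ≤ 2 * G)
    (hE : |e| ≤ (K + 1) * (ε * G)) (hR : R = (1 + c) * G + (G - F) - e)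
    (hsum : -r₁ + r₂ ≤ (2 * z + 2 * w) * (w * V) + 20 * N * (2 * K + 12) ^ 2 * ε * G) :
    ∃ D, 0 < D ∧ F * ((z + (c - w * s)) ^ 2 - z * (z + (c - w * s))) -
      (-R * (1 + c - z) + r₁) + r₂ ≤ D ∧ (1 + γ) * G * D ≤ R ^ 2 := by
  obtain ⟨hε1, hKε, hNε, hMbig⟩ := small_parameter_bounds hK hN hε hεN
  obtain ⟨μ, hμ⟩ : ∃ μ : ℝ, μ = 100 * (N + 1) * (2 * K + 12) ^ 2 * ε := ⟨_, rfl⟩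
  rw [← hμ] at hεN hMbig
  have hμ0 : 0 ≤ μ := by rw [hμ]; positivity
  clear hμ
  have hK3 : (0 : ℝ) < K + 3 := by positivity
  have hz0 : 0 < z := pos_of_mul_pos_left (by rw [hzK]; exact one_pos) hK3.le
  have hz3 : z ≤ 1 / 3 := by nlinarith
  have hμz : 100 * μ ≤ z := by
    refine le_of_mul_le_mul_right ?_ hK3
    rw [hzK]; linarith
  have hγz : 11 * γ ≤ z := by
    refine le_of_mul_le_mul_right ?_ hK3
    rw [hzK]; linarith
  have hMG := mul_le_mul_of_nonneg_right hMbig hG.le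
  have hεG : 0 ≤ ε * G := by positivity
  have hKG : 0 ≤ K * (ε * G) := by positivity
  have hNG : 0 ≤ N * (ε * G) := by positivity
  have hMN : 0 ≤ 20 * N * (2 * K + 12) ^ 2 * ε * G := by positivity
  have hcGε : |c * G| ≤ ε * G := by rw [abs_mul, abs_of_pos hG]; gcongr
  obtain ⟨hc1, hc2⟩ := _root_.abs_le.1 hcGε
  obtain ⟨he1, he2⟩ := _root_.abs_le.1 hE
  obtain ⟨hv1, hv2⟩ := _root_.abs_le.1 hwVg
  have hRlo : G + (G - F) - (K + 2) * (ε * G) ≤ R := by rw [hR]; linarith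
  have hRhi : R ≤ G + (G - F) + (K + 2) * (ε * G) := by rw [hR]; linarith
  have hR0 : |R| ≤ 3 * G := by
    have := mul_le_mul_of_nonneg_right hKε hG.le
    rw [_root_.abs_le]
    constructor <;> linarith
  have hc1' : |c - w * s| ≤ (N + 1) * ε := by
    refine (abs_sub _ _).trans ?_
    rw [abs_mul, abs_of_pos hw0]
    have : w * |s| ≤ 1 * (N * ε) := by gcongr; linarith
    linarith
  have hDen1 : F * ((z + (c - w * s)) ^ 2 - z * (z + (c - w * s))) ≤
      4 * ((N + 1) * (ε * G)) := by
    have e1 : (z + (c - w * s)) ^ 2 - z * (z + (c - w * s)) =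
      (c - w * s) * (z + (c - w * s)) := by ring
    have h1 : |z + (c - w * s)| ≤ 2 := by
      refine (abs_add_le _ _).trans ?_
      rw [abs_of_pos hz0]
      linarith
    calc _ ≤ F * (|c - w * s| * |z + (c - w * s)|) := by
          rw [e1, ← abs_mul]; gcongr; exact le_abs_self _
      _ ≤ (2 * G) * (((N + 1) * ε) * 2) := by gcongr
      _ = _ := by ring
  have hDen2 : R * (1 + c - z) ≤ (G + (G - F)) * (1 - z) + (K + 2) * (ε * G) + 3 * (ε * G) := by
    have h1 : R * c ≤ 3 * (ε * G) := by
      calc R * c ≤ |R| * |c| := by rw [← abs_mul]; exact le_abs_self _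
        _ ≤ 3 * G * ε := by gcongr
        _ = _ := by ring
    have h2 : R * (1 - z) ≤ (G + (G - F) + (K + 2) * (ε * G)) * (1 - z) :=
      mul_le_mul_of_nonneg_right hRhi (by linarith)
    have h3 : 0 ≤ ((K + 2) * (ε * G)) * z := by positivity
    linarith
  have hDen3 : (2 * z + 2 * w) * (w * V) ≤ (2 * z + 2 * w) * (G - F) + 2 * (ε * G) := by
    have h1 : (2 * z + 2 * w) * (w * V) ≤ (2 * z + 2 * w) * ((G - F) + ε * G) :=
      mul_le_mul_of_nonneg_left (by linarith) (by positivity)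
    have h2 : (2 * z + 2 * w) * (ε * G) ≤ 2 * (ε * G) :=
      mul_le_mul_of_nonneg_right (by linarith) hεG
    linarith
  -- Since `2 w ≤ 1` and `g ≥ -ε G`, the coefficient `1 + z + 2 w` of `g` may be raised to `2 + z`.
  have hDen4 : (2 * w - 1) * (G - F) ≤ ε * G := by
    have h1 : (1 - 2 * w) * -(ε * G) ≤ (1 - 2 * w) * (G - F) :=
      mul_le_mul_of_nonneg_left hgl (by linarith)
    have h2 : 0 ≤ w * (ε * G) := by positivity
    linarith
  obtain ⟨D, hD⟩ : ∃ D, D = G * (1 - z) + (2 + z) * (G - F) + μ * G := ⟨_, rfl⟩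
  obtain ⟨hDpos, hRD⟩ := quadratic_bound (R := R) hG hμ0 hz0 hz3 hμz hγ0 hγz
    (by linarith) (by linarith) (by linarith) hD
  refine ⟨D, hDpos, ?_, hRD⟩
  rw [hD]
  linarith

end RealInequalities

/-! ### The concavity inequality for `σ_{K+2}` at a normalised point. -/

section Main

variable {ι : Type*} [DecidableEq ι] {x : ι → ℝ} {K : ℕ} {S A : Finset ι} {i₁ : ι} {ε : ℝ}

theorem IsSplitting.defect_sum_le {N : ℕ} (P : IsSplitting x S K A i₁ ε) (hN : S.card ≤ N)
    (h : InCone x S (K + 2)) (hε : 0 < ε) (hε1 : ε ≤ 1) (hx₁ : x i₁ = 1)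
    (habs : ∀ i ∈ S, |x i| ≤ 1) {c z w β : ℝ} (hc : |c| ≤ ε) (hz0 : 0 ≤ z) (hz1 : z ≤ 1)
    (hw0 : 0 ≤ w) (hw1 : w ≤ 1) (hβ0 : 0 ≤ β) (hβ : β ≤ 1 / 2 + ε) :
    ∑ i ∈ S.erase i₁, (-(rowDefect x S K A i₁ c w i * testVector x A i₁ c z w i) +
        β * (rowDefect x S K A i₁ c w i ^ 2 / esymmOn x (S.erase i) (K + 1))) ≤
      (2 * z + 2 * w) * (w * ∑ i ∈ S \ A, x i ^ 2 * esymmOn x (S.erase i) (K + 1)) +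
        20 * N * (2 * K + 12) ^ 2 * ε * esymmOn x (S.erase i₁) (K + 1) := by
  have hi₁ := P.subset P.mem
  have hK : (0 : ℝ) ≤ K := Nat.cast_nonneg K
  have hG : 0 < esymmOn x (S.erase i₁) (K + 1) := (h.erase hi₁) _ le_rfl
  have hterm : ∀ i ∈ S.erase i₁,
      -(rowDefect x S K A i₁ c w i * testVector x A i₁ c z w i) +
        β * (rowDefect x S K A i₁ c w i ^ 2 / esymmOn x (S.erase i) (K + 1)) ≤
      (if i ∈ A then 0 else (2 * z + 2 * w) * w * (x i ^ 2 * esymmOn x (S.erase i) (K + 1))) +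
        20 * ((2 * K + 12) ^ 2 * ε * esymmOn x (S.erase i₁) (K + 1)) := by
    intro i hi'
    obtain ⟨hne, hi⟩ := Finset.mem_erase.1 hi'
    have hFi : 0 < esymmOn x (S.erase i) (K + 1) := (h.erase hi) _ le_rfl
    have hr := P.sq_rowError_le h hε hε1 hx₁ habs hc hw0 hw1 hi hne
    have hv := P.sq_mul_deriv_le h hε hε1 hx₁ habs hi
    unfold rowDefect testVector
    rw [if_neg hne, if_neg hne]
    by_cases hiA : i ∈ A
    · simp only [if_pos hiA, zero_add, zero_sub, mul_zero, sub_zero]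
      have := large_index_bound hFi hG.le hε.le hε1 hz0 hz1 hβ (by linarith) (by linarith)
        hv hr
      linarith
    · simp only [if_neg hiA]
      have := small_index_bound hFi hG.le hε.le hε1 hz0 hz1 hw0 hw1 hβ0 hβ (by linarith)
        (by linarith) (P.abs_le i (Finset.mem_sdiff.2 ⟨hi, hiA⟩)) hv hr
      linarith
  refine (Finset.sum_le_sum hterm).trans ?_
  rw [Finset.sum_add_distrib]
  have h1 : ∑ i ∈ S.erase i₁, (if i ∈ A then 0 else
      (2 * z + 2 * w) * w * (x i ^ 2 * esymmOn x (S.erase i) (K + 1))) =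
      (2 * z + 2 * w) * (w * ∑ i ∈ S \ A, x i ^ 2 * esymmOn x (S.erase i) (K + 1)) := by
    rw [Finset.sum_erase S (a := i₁) (by rw [if_pos P.mem]), Finset.sdiff_eq_filter, Finset.sum_filter,
      Finset.mul_sum, Finset.mul_sum]
    refine Finset.sum_congr rfl fun i _ => ?_
    by_cases hiA : i ∈ A
    · simp [hiA]
    · simp only [if_neg hiA, if_pos hiA]
      ring
  rw [h1, Finset.sum_const, nsmul_eq_mul]
  have h2 : ((S.erase i₁).card : ℝ) ≤ N := by exact_mod_cast (Finset.card_erase_le).trans hN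
  have h3 : ((S.erase i₁).card : ℝ) * (20 * ((2 * K + 12) ^ 2 * ε *
      esymmOn x (S.erase i₁) (K + 1))) ≤ N * (20 * ((2 * K + 12) ^ 2 * ε *
      esymmOn x (S.erase i₁) (K + 1))) := by gcongr
  linarith

theorem IsSplitting.concavity {N : ℕ} (P : IsSplitting x S K A i₁ ε) (hN : S.card ≤ N)
    (h : InCone x S (K + 2)) (hε : 0 < ε) (hx₁ : x i₁ = 1)
    (habs : ∀ i ∈ S, |x i| ≤ 1) {δ γ : ℝ} (hδ0 : 0 ≤ δ) (hδ : δ ≤ ε) (hγ0 : 0 ≤ γ)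
    (hγ : 11 * (K + 3) * γ ≤ 1)
    (hεN : 100 * (K + 3) * (100 * (N + 1) * (2 * K + 12) ^ 2 * ε) ≤ 1) (ξ : ι → ℝ) :
    (1 + γ) * (esymmOn x (S.erase i₁) (K + 1) * ξ i₁ ^ 2) ≤
      -(∑ p ∈ S, ∑ q ∈ S.erase p, ξ p * ξ q * esymmOn x ((S.erase p).erase q) K) +
        2 * ((∑ i ∈ S, ξ i * esymmOn x (S.erase i) (K + 1)) ^ 2 / esymmOn x S (K + 2)) +
        2 / (1 + 2 * δ) * ∑ i ∈ S.erase i₁, esymmOn x (S.erase i) (K + 1) * ξ i ^ 2 := by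
  have hi₁ := P.subset P.mem
  have hK : (0 : ℝ) ≤ K := Nat.cast_nonneg K
  have hNn : (0 : ℝ) ≤ N := Nat.cast_nonneg N
  have hG : 0 < esymmOn x (S.erase i₁) (K + 1) := (h.erase hi₁) _ le_rfl
  have hF : 0 < esymmOn x S (K + 2) := h _ le_rfl
  obtain ⟨hε1, hKε, hNε, -⟩ := small_parameter_bounds hK hNn hε hεN
  -- This `z` makes `C - z` equal to `z` up to small errors, so that the coefficient `(C - z)² - z
  -- (C - z)` of `σ` is negligible.
  obtain ⟨z, hz⟩ : ∃ z : ℝ, z = 1 / (K + 3) := ⟨_, rfl⟩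
  have hz0 : 0 < z := by rw [hz]; positivity
  have hzK : z * (K + 3) = 1 := by rw [hz]; field_simp
  have hz3 : z ≤ 1 / 3 := by nlinarith
  have ha := P.two_le
  obtain ⟨w, hwdef⟩ : ∃ w : ℝ, w = 1 / ((K : ℝ) + 3 - A.card) := ⟨_, rfl⟩
  have hw0 : 0 < w := by rw [hwdef]; positivity
  have hw : w * ((K : ℝ) + 3 - A.card) = 1 := by rw [hwdef]; field_simp
  have hw2 : w ≤ 1 / 2 := by nlinarith
  obtain ⟨V, hV⟩ : ∃ V, V = ∑ i ∈ S \ A, x i ^ 2 * esymmOn x (S.erase i) (K + 1) := ⟨_, rfl⟩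
  have hVg := P.abs_sum_sub_le
  rw [← hV] at hVg
  have hwVg : |w * V - (esymmOn x (S.erase i₁) (K + 1) - esymmOn x S (K + 2))| ≤
      ε * esymmOn x (S.erase i₁) (K + 1) := by
    have e : w * V - (esymmOn x (S.erase i₁) (K + 1) - esymmOn x S (K + 2)) =
        w * (V - ((K : ℝ) + 3 - A.card) *
          (esymmOn x (S.erase i₁) (K + 1) - esymmOn x S (K + 2))) := by
      linear_combination (esymmOn x (S.erase i₁) (K + 1) - esymmOn x S (K + 2)) * hw
    rw [e, abs_mul, abs_of_pos hw0]
    calc _ ≤ 1 * (ε * esymmOn x (S.erase i₁) (K + 1)) := by gcongr; linarith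
      _ = _ := one_mul _
  -- The correction `c` makes the derivative of `σ` along the test vector exactly `z σ`; it is small
  -- because `w V` is close to `G - σ`.
  obtain ⟨c, hcdef⟩ : ∃ c : ℝ, c = (w * V - (esymmOn x (S.erase i₁) (K + 1) -
    esymmOn x S (K + 2))) / esymmOn x (S.erase i₁) (K + 1) := ⟨_, rfl⟩
  have hcG : c * esymmOn x (S.erase i₁) (K + 1) =
      w * V - (esymmOn x (S.erase i₁) (K + 1) - esymmOn x S (K + 2)) := by
    rw [hcdef]; field_simp
  have hc : |c| ≤ ε := by
    rw [hcdef, abs_div, abs_of_pos hG, div_le_iff₀ hG]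
    exact hwVg
  have hgl := P.neg_le h hε
  have hF2 := P.le_two_mul h hε hε1
  obtain ⟨s, hs⟩ : ∃ s, s = ∑ q ∈ S \ A, x q := ⟨_, rfl⟩
  have hsN : |s| ≤ N * ε := by
    rw [hs]
    calc _ ≤ ∑ i ∈ S \ A, |x i| := Finset.abs_sum_le_sum_abs _ _
      _ ≤ (S \ A).card • ε := Finset.sum_le_card_nsmul _ _ _ P.abs_le
      _ ≤ _ := by
        rw [nsmul_eq_mul]
        gcongr
        exact (Finset.card_le_card Finset.sdiff_subset).trans hN
  obtain ⟨β, hβ⟩ : ∃ β : ℝ, β = (1 + 2 * δ) / 2 := ⟨_, rfl⟩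
  have hβ0 : 0 < β := by rw [hβ]; positivity
  have hβε : β ≤ 1 / 2 + ε := by linarith
  have hrow : ∀ i ∈ S, ∑ q ∈ S.erase i, testVector x A i₁ c z w q *
      esymmOn x ((S.erase i).erase q) K =
      (1 + c - (K + 1) * z - w * s) * esymmOn x (S.erase i) (K + 1) +
        rowDefect x S K A i₁ c w i := fun i hi => by
    rw [hs]; exact sum_testVector_mul_hessian_eq P.subset P.mem hx₁ hw hi
  have hd : ∑ i ∈ S, testVector x A i₁ c z w i * esymmOn x (S.erase i) (K + 1) =
      z * esymmOn x S (K + 2) := by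
    rw [sum_testVector_mul_deriv hi₁, ← hV]
    linear_combination hcG - esymmOn x S (K + 2) * hzK
  have hsum := P.defect_sum_le hN h hε hε1 hx₁ habs hc hz0.le (by linarith) hw0.le
    (by linarith) hβ0.le hβε
  rw [← hV, Finset.sum_add_distrib, Finset.sum_neg_distrib, ← Finset.mul_sum] at hsum
  have hχ₁ : testVector x A i₁ c z w i₁ = 1 + c - z := by
    unfold testVector
    rw [if_pos rfl, if_pos P.mem, hx₁]
    ring
  have hE : |w * ∑ p ∈ A.erase i₁, esymmOn x ((S.erase p).erase i₁) (K + 2)| ≤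
      (K + 1) * (ε * esymmOn x (S.erase i₁) (K + 1)) := by
    rw [abs_mul, abs_of_pos hw0]
    calc _ ≤ 1 * ((K + 1) * (ε * esymmOn x (S.erase i₁) (K + 1))) := by
          refine mul_le_mul (by linarith) ?_ (abs_nonneg _) zero_le_one
          calc _ ≤ ∑ p ∈ A.erase i₁, |esymmOn x ((S.erase p).erase i₁) (K + 2)| :=
                Finset.abs_sum_le_sum_abs _ _
            _ ≤ (A.erase i₁).card • (ε * esymmOn x (S.erase i₁) (K + 1)) :=
              Finset.sum_le_card_nsmul _ _ _ fun p hp => abs_le_of_sq_le_sq (by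
                have := P.sq_le p (Finset.mem_of_mem_erase hp) i₁ hi₁
                  (Finset.ne_of_mem_erase hp).symm
                rw [mul_pow]; linarith) (by positivity)
            _ ≤ _ := by
              rw [nsmul_eq_mul]
              gcongr
              exact_mod_cast (Finset.card_erase_le).trans P.card_le
      _ = _ := one_mul _
  obtain ⟨R, hR⟩ : ∃ R, R = -rowDefect x S K A i₁ c w i₁ := ⟨_, rfl⟩
  have hR' : R = (1 + c) * esymmOn x (S.erase i₁) (K + 1) +
      (esymmOn x (S.erase i₁) (K + 1) - esymmOn x S (K + 2)) -
      w * ∑ p ∈ A.erase i₁, esymmOn x ((S.erase p).erase i₁) (K + 2) := by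
    rw [hR]; unfold rowDefect; rw [if_pos rfl, neg_neg]
  have hbound := fun t => h.hessian_lower_bound hi₁ hβ0 hrow hd ξ t
  rw [← Finset.add_sum_erase S (fun i => rowDefect x S K A i₁ c w i * testVector x A i₁ c z w i)
    hi₁, hχ₁, show rowDefect x S K A i₁ c w i₁ = -R by rw [hR, neg_neg],
    show 1 / β = 2 / (1 + 2 * δ) by rw [hβ, one_div_div]] at hbound
  generalize -(∑ p ∈ S, ∑ q ∈ S.erase p, ξ p * ξ q * esymmOn x ((S.erase p).erase q) K) +
        2 * ((∑ i ∈ S, ξ i * esymmOn x (S.erase i) (K + 1)) ^ 2 / esymmOn x S (K + 2)) +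
        2 / (1 + 2 * δ) * ∑ i ∈ S.erase i₁, esymmOn x (S.erase i) (K + 1) * ξ i ^ 2 = T at *
  generalize ∑ i ∈ S.erase i₁, rowDefect x S K A i₁ c w i * testVector x A i₁ c z w i = r₁ at *
  generalize β * ∑ i ∈ S.erase i₁, rowDefect x S K A i₁ c w i ^ 2 /
    esymmOn x (S.erase i) (K + 1) = r₂ at *
  generalize w * ∑ p ∈ A.erase i₁, esymmOn x ((S.erase p).erase i₁) (K + 2) = e at *
  generalize esymmOn x (S.erase i₁) (K + 1) = G at *
  generalize esymmOn x S (K + 2) = F at *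
  generalize ξ i₁ = y at *
  obtain ⟨D, hDpos, hA1, hRD⟩ := exists_denominator_bound hK hNn hε hεN hγ0 hγ hG hF hzK hw0
    hw2 hc hsN hwVg hgl hF2 hE hR' hsum
  have hC : (1 + c - (K + 1) * z - w * s) - z = z + (c - w * s) := by
    linear_combination -hzK
  -- The maximiser over `t` of `2 t R y - t² D`.
  have hfin := hbound (R * y / D)
  rw [hC] at hfin
  have hstep : (R * y) ^ 2 / D ≤ T := by
    refine le_trans ?_ hfin
    have h1 : (R * y / D) ^ 2 * (F * ((z + (c - w * s)) ^ 2 - z * (z + (c - w * s))) -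
        (-R * (1 + c - z) + r₁) + r₂) ≤ (R * y / D) ^ 2 * D := by gcongr
    have h2 : (R * y) ^ 2 / D = -2 * (R * y / D) * (-R * y) - (R * y / D) ^ 2 * D := by
      field_simp
      ring
    linarith
  refine le_trans ?_ hstep
  rw [le_div_iff₀ hDpos]
  calc (1 + γ) * (G * y ^ 2) * D = (1 + γ) * G * D * y ^ 2 := by ring
    _ ≤ R ^ 2 * y ^ 2 := by gcongr
    _ = _ := by ring

end Main

/-! ### Homogeneity: from the normalised point back to the original one. -/

section Scaling

variable {ι : Type*} [DecidableEq ι]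

theorem concavity_of_scaled {v : ι → ℝ} {S : Finset ι} {K : ℕ} {i₁ : ι} {L γ κ : ℝ} (hL : 0 < L)
    (hF : 0 < esymmOn v S (K + 2)) {ξ : ι → ℝ}
    (h : (1 + γ) * (esymmOn (fun i => L⁻¹ * v i) (S.erase i₁) (K + 1) * ξ i₁ ^ 2) ≤
      -(∑ p ∈ S, ∑ q ∈ S.erase p,
          ξ p * ξ q * esymmOn (fun i => L⁻¹ * v i) ((S.erase p).erase q) K) +
        2 * ((∑ i ∈ S, ξ i * esymmOn (fun i => L⁻¹ * v i) (S.erase i) (K + 1)) ^ 2 /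
          esymmOn (fun i => L⁻¹ * v i) S (K + 2)) +
        κ * ∑ i ∈ S.erase i₁, esymmOn (fun i => L⁻¹ * v i) (S.erase i) (K + 1) * ξ i ^ 2) :
    (1 + γ) * (esymmOn v (S.erase i₁) (K + 1) * ξ i₁ ^ 2 / (L * esymmOn v S (K + 2))) ≤
      -((∑ p ∈ S, ∑ q ∈ S.erase p, ξ p * ξ q * esymmOn v ((S.erase p).erase q) K) /
          esymmOn v S (K + 2)) +
        2 * ((∑ i ∈ S, ξ i * esymmOn v (S.erase i) (K + 1)) ^ 2 / esymmOn v S (K + 2) ^ 2) +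
        κ * ((∑ i ∈ S.erase i₁, esymmOn v (S.erase i) (K + 1) * ξ i ^ 2) /
          (L * esymmOn v S (K + 2))) := by
  have e1 : ∑ p ∈ S, ∑ q ∈ S.erase p, ξ p * ξ q * (L⁻¹ ^ K * esymmOn v ((S.erase p).erase q) K) =
      L⁻¹ ^ K * ∑ p ∈ S, ∑ q ∈ S.erase p, ξ p * ξ q * esymmOn v ((S.erase p).erase q) K := by
    simp only [Finset.mul_sum]
    exact Finset.sum_congr rfl fun p _ => Finset.sum_congr rfl fun q _ => by ring
  have e2 : ∑ i ∈ S, ξ i * (L⁻¹ ^ (K + 1) * esymmOn v (S.erase i) (K + 1)) =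
      L⁻¹ ^ (K + 1) * ∑ i ∈ S, ξ i * esymmOn v (S.erase i) (K + 1) := by
    simp only [Finset.mul_sum]
    exact Finset.sum_congr rfl fun p _ => by ring
  have e3 : ∑ i ∈ S.erase i₁, L⁻¹ ^ (K + 1) * esymmOn v (S.erase i) (K + 1) * ξ i ^ 2 =
      L⁻¹ ^ (K + 1) * ∑ i ∈ S.erase i₁, esymmOn v (S.erase i) (K + 1) * ξ i ^ 2 := by
    simp only [Finset.mul_sum, mul_assoc]
  simp only [esymmOn_smul] at h
  rw [e1, e2, e3] at h
  generalize ∑ p ∈ S, ∑ q ∈ S.erase p, ξ p * ξ q * esymmOn v ((S.erase p).erase q) K = Q at *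
  generalize ∑ i ∈ S, ξ i * esymmOn v (S.erase i) (K + 1) = d at *
  generalize ∑ i ∈ S.erase i₁, esymmOn v (S.erase i) (K + 1) * ξ i ^ 2 = T at *
  generalize esymmOn v (S.erase i₁) (K + 1) = G at *
  generalize esymmOn v S (K + 2) = F at *
  have hpos : 0 < L ^ K / F := by positivity
  calc _ = L ^ K / F * ((1 + γ) * (L⁻¹ ^ (K + 1) * G * ξ i₁ ^ 2)) := by
        simp only [inv_pow]
        field_simp
        ring
    _ ≤ _ := mul_le_mul_of_nonneg_left h hpos.le
    _ = _ := by
      simp only [inv_pow]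
      field_simp
      ring

end Scaling

/-! ### The sum Hessian operator as `σ_k` of the appended vector. -/

section Fin

theorem sum_append_zero {n m : ℕ} {f : Fin (n + m) → ℝ} (hf : ∀ j, f (Fin.natAdd n j) = 0) :
    ∑ i, f i = ∑ i, f (Fin.castAdd m i) := by
  rw [Fin.sum_univ_add]
  simp [hf]

theorem sum_erase_append_zero {n m : ℕ} {f : Fin (n + m) → ℝ} (hf : ∀ j, f (Fin.natAdd n j) = 0)
    (p : Fin n) :
    ∑ i ∈ univ.erase (Fin.castAdd m p), f i = ∑ i ∈ univ.erase p, f (Fin.castAdd m i) := by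
  rw [Finset.sum_erase_eq_sub (mem_univ _), Finset.sum_erase_eq_sub (mem_univ _),
    sum_append_zero hf]

theorem sigma_eq_esymmOn {n : ℕ} (k : ℕ) (x : Fin n → ℝ) : sigma k x = esymmOn x univ k := by
  simp [sigma, MvPolynomial.esymm, esymmOn, map_sum, map_prod]

open Polynomial in
theorem esymmOn_append {n m : ℕ} (x : Fin n → ℝ) (y : Fin m → ℝ) (k : ℕ) :
    esymmOn (Fin.append x y) univ k =
      ∑ j ∈ range (k + 1), esymmOn y univ j * esymmOn x univ (k - j) := by
  rw [← coeff_prod_one_add_C_mul_X, Fin.prod_univ_add, mul_comm, coeff_mul,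
    Finset.Nat.sum_antidiagonal_eq_sum_range_succ_mk]
  simp only [Fin.append_left, Fin.append_right, coeff_prod_one_add_C_mul_X]

open Polynomial in
theorem HasRealRoots.eq_esymmOn {m : ℕ} {a y : Fin m → ℝ} (h : HasRealRoots a y) (r : Fin m) :
    a r = esymmOn y univ (r + 1) := by
  have hdeg : (∑ r : Fin m, C ((-1 : ℝ) ^ ((r : ℕ) + 1) * a r) * X ^ (m - ((r : ℕ) + 1))).degree
      < (m : WithBot ℕ) := by
    refine mem_degreeLT.1 (Submodule.sum_mem _ fun r _ => mem_degreeLT.2 ?_)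
    refine (degree_C_mul_X_pow_le _ _).trans_lt ?_
    have := r.2
    exact_mod_cast (by omega : m - ((r : ℕ) + 1) < m)
  have hmonic : (rootPolynomial a).Monic := monic_X_pow_add hdeg
  have hnat : (rootPolynomial a).natDegree = m := natDegree_eq_of_degree_eq_some (by
    rw [rootPolynomial, degree_add_eq_left_of_degree_lt (by rwa [degree_X_pow]), degree_X_pow])
  have hroots : (rootPolynomial a).roots = univ.val.map y := h
  have hcard : Multiset.card (rootPolynomial a).roots = (rootPolynomial a).natDegree := by
    rw [hroots, hnat]; simp
  have hr := r.2
  have hc := coeff_eq_esymm_roots_of_card hcard (k := m - ((r : ℕ) + 1)) (by omega)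
  rw [hmonic.leadingCoeff, hnat, hroots, Finset.esymm_map_val, one_mul,
    show m - (m - ((r : ℕ) + 1)) = r + 1 by omega] at hc
  have hl : (rootPolynomial a).coeff (m - ((r : ℕ) + 1)) = (-1 : ℝ) ^ ((r : ℕ) + 1) * a r := by
    rw [rootPolynomial, coeff_add, coeff_X_pow, if_neg (by omega), zero_add, finsetSum_coeff,
      Finset.sum_eq_single r]
    · rw [coeff_C_mul, coeff_X_pow, if_pos rfl, mul_one]
    · intro b _ hb
      rw [coeff_C_mul, coeff_X_pow, if_neg, mul_zero]
      have := b.2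
      intro hh
      exact hb (Fin.ext (by omega))
    · simp
  rw [hl] at hc
  exact mul_left_cancel₀ (pow_ne_zero _ (by norm_num)) hc

/-- In the convolution formula for `σ_k(x, y)` the terms with `j > m` vanish, and `m < k` keeps all
the others in range. -/
theorem HasRealRoots.sumHessian_eq {n m k : ℕ} {a y : Fin m → ℝ} (h : HasRealRoots a y)
    (hmk : m < k) (x : Fin n → ℝ) :
    sumHessian k a x = esymmOn (Fin.append x y) univ k := by
  rw [esymmOn_append, ← Finset.sum_subset (s₁ := range (m + 1))
    (Finset.range_subset_range.2 (by omega)) (fun j _ hj => by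
      rw [esymmOn_eq_zero y (by rw [Finset.card_univ, Fintype.card_fin]; simpa using hj),
        zero_mul]), Finset.sum_range_succ', sumHessian, Finset.sum_range, add_comm]
  simp only [sigma_eq_esymmOn, esymmOn_zero, one_mul, Nat.sub_zero]
  congr 1
  exact Finset.sum_congr rfl fun r _ => by rw [h.eq_esymmOn r]

/-- Elementary symmetric functions are affine in each variable, so the line derivative is the slope.
-/
theorem partialD_esymmOn_append {n m : ℕ} (y : Fin m → ℝ) {W : Finset (Fin (n + m))} (j : ℕ)
    {p : Fin n} (hp : Fin.castAdd m p ∈ W) :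
    partialD p (fun x => esymmOn (Fin.append x y) W (j + 1)) =
      fun x => esymmOn (Fin.append x y) (W.erase (Fin.castAdd m p)) j := by
  funext x
  have hne : ∀ t : ℝ, ∀ i ∈ W.erase (Fin.castAdd m p),
      Fin.append (x + t • Pi.single p 1) y i = Fin.append x y i := by
    intro t i hi
    have hi' := Finset.ne_of_mem_erase hi
    induction i using Fin.addCases with
    | left i =>
      have : i ≠ p := fun h => hi' (by rw [h])
      simp [this]
    | right i => simp
  have haff : (fun t : ℝ => esymmOn (Fin.append (x + t • Pi.single p 1) y) W (j + 1)) =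
      fun t => (esymmOn (Fin.append x y) (W.erase (Fin.castAdd m p)) (j + 1) +
        x p * esymmOn (Fin.append x y) (W.erase (Fin.castAdd m p)) j) +
        t * esymmOn (Fin.append x y) (W.erase (Fin.castAdd m p)) j := by
    funext t
    rw [esymmOn_erase _ hp, esymmOn_congr (hne t), esymmOn_congr (hne t)]
    simp
    ring
  rw [partialD, lineDeriv, haff]
  simp

end Fin

/-! ### Transfer of the inequality to the sum Hessian operator. -/

section SumHessian

theorem append_gardingCone_inCone {n m k : ℕ} {lam : Fin n → ℝ} {y : Fin m → ℝ}
    (h : Fin.append lam y ∈ gardingCone k (n + m)) : InCone (Fin.append lam y) univ k := by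
  intro i hi
  rcases Nat.eq_zero_or_pos i with rfl | hpos
  · simp
  · rw [← sigma_eq_esymmOn]
    exact h i hpos hi

theorem InCone.smul {ι : Type*} [DecidableEq ι] {x : ι → ℝ} {S : Finset ι} {k : ℕ}
    (h : InCone x S k) {c : ℝ} (hc : 0 < c) : InCone (fun i => c * x i) S k := by
  intro i hi
  rw [esymmOn_smul]
  exact mul_pos (pow_pos hc i) (h i hi)

/-- The concavity inequality at a point, once it is known for the elementary symmetric function
of the combined variables `(lam, y)`. -/
theorem HasRealRoots.concavity_of_esymmOn {n m K : ℕ} {a y : Fin m → ℝ} (h : HasRealRoots a y)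
    (hmk : m < K + 2) {lam ξ : Fin n → ℝ} {i₁ : Fin n} {γ δ : ℝ}
    (hmain : (1 + γ) * (esymmOn (Fin.append lam y) (univ.erase (Fin.castAdd m i₁)) (K + 1) *
        Fin.append ξ (0 : Fin m → ℝ) (Fin.castAdd m i₁) ^ 2 /
          (lam i₁ * esymmOn (Fin.append lam y) univ (K + 2))) ≤
      -((∑ p, ∑ q ∈ univ.erase p, Fin.append ξ (0 : Fin m → ℝ) p * Fin.append ξ (0 : Fin m → ℝ) q *
          esymmOn (Fin.append lam y) ((univ.erase p).erase q) K) /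
          esymmOn (Fin.append lam y) univ (K + 2)) +
        2 * ((∑ i, Fin.append ξ (0 : Fin m → ℝ) i *
          esymmOn (Fin.append lam y) (univ.erase i) (K + 1)) ^ 2 /
            esymmOn (Fin.append lam y) univ (K + 2) ^ 2) +
        2 / (1 + 2 * δ) * ((∑ i ∈ univ.erase (Fin.castAdd m i₁),
          esymmOn (Fin.append lam y) (univ.erase i) (K + 1) *
            Fin.append ξ (0 : Fin m → ℝ) i ^ 2) /
          (lam i₁ * esymmOn (Fin.append lam y) univ (K + 2)))) :
    (1 + γ) * (partialD i₁ (sumHessian (K + 2) a) lam * ξ i₁ ^ 2 /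
        (lam i₁ * sumHessian (K + 2) a lam)) ≤
      -(∑ p : Fin n, ∑ q ∈ univ.erase p, partialD q (partialD p (sumHessian (K + 2) a)) lam *
          ξ p * ξ q / sumHessian (K + 2) a lam) +
        2 * ((∑ i : Fin n, partialD i (sumHessian (K + 2) a) lam * ξ i) ^ 2 /
          sumHessian (K + 2) a lam ^ 2) +
        2 * ∑ i ∈ univ.erase i₁, partialD i (sumHessian (K + 2) a) lam * ξ i ^ 2 /
          ((1 + 2 * δ) * lam i₁ * sumHessian (K + 2) a lam) := by
  have hF : sumHessian (n := n) (K + 2) a = fun x => esymmOn (Fin.append x y) univ (K + 2) :=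
    funext fun x => h.sumHessian_eq hmk x
  have hd : ∀ p : Fin n, partialD p (sumHessian (K + 2) a) =
      fun x => esymmOn (Fin.append x y) (univ.erase (Fin.castAdd m p)) (K + 1) := fun p => by
    rw [hF]
    exact partialD_esymmOn_append y (K + 1) (mem_univ _)
  have hdd : ∀ p : Fin n, ∀ q ∈ univ.erase p, partialD q (partialD p (sumHessian (K + 2) a)) lam =
      esymmOn (Fin.append lam y)
        ((univ.erase (Fin.castAdd m p)).erase (Fin.castAdd m q)) K := fun p q hq => by
    rw [hd, partialD_esymmOn_append y K]
    refine Finset.mem_erase.2 ⟨fun h => Finset.ne_of_mem_erase hq ?_, mem_univ _⟩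
    exact Fin.castAdd_injective n m h
  have e1 : ∑ p, ∑ q ∈ univ.erase p,
      Fin.append ξ (0 : Fin m → ℝ) p * Fin.append ξ (0 : Fin m → ℝ) q *
        esymmOn (Fin.append lam y) ((univ.erase p).erase q) K =
      ∑ p : Fin n, ∑ q ∈ univ.erase p,
        partialD q (partialD p (sumHessian (K + 2) a)) lam * ξ p * ξ q := by
    rw [sum_append_zero (fun j => by simp)]
    refine Finset.sum_congr rfl fun p _ => ?_
    rw [sum_erase_append_zero (fun j => by simp)]
    refine Finset.sum_congr rfl fun q hq => ?_
    rw [hdd p q hq, Fin.append_left, Fin.append_left]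
    ring
  have e2 : ∑ i, Fin.append ξ (0 : Fin m → ℝ) i *
      esymmOn (Fin.append lam y) (univ.erase i) (K + 1) =
      ∑ i : Fin n, partialD i (sumHessian (K + 2) a) lam * ξ i := by
    rw [sum_append_zero (fun j => by simp)]
    refine Finset.sum_congr rfl fun p _ => ?_
    rw [hd, Fin.append_left]
    ring
  have e3 : ∑ i ∈ univ.erase (Fin.castAdd m i₁),
      esymmOn (Fin.append lam y) (univ.erase i) (K + 1) * Fin.append ξ (0 : Fin m → ℝ) i ^ 2 =
      ∑ i ∈ univ.erase i₁, partialD i (sumHessian (K + 2) a) lam * ξ i ^ 2 := by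
    rw [sum_erase_append_zero (fun j => by simp)]
    refine Finset.sum_congr rfl fun p _ => ?_
    rw [hd, Fin.append_left]
  rw [e1, e2, e3, Fin.append_left, ← h.sumHessian_eq hmk] at hmain
  have hd1 : partialD i₁ (sumHessian (K + 2) a) lam =
    esymmOn (Fin.append lam y) (univ.erase (Fin.castAdd m i₁)) (K + 1) := by rw [hd]
  rw [← hd1] at hmain
  refine hmain.trans (le_of_eq ?_)
  simp only [← Finset.sum_div]
  rw [mul_assoc (1 + 2 * δ), div_mul_div_comm, mul_div_assoc]

end SumHessian

/-! ### Choice of constants and conclusion. -/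

theorem lemma3p2 (n k : ℕ) (hn : 3 ≤ n) (hkn : k ≤ n) (s : ℝ) :
    ∃ δ₀ : ℝ, 0 < δ₀ ∧ δ₀ < 1 ∧ ∃ Λ : ℝ, 0 < Λ ∧
      ∀ δ : ℝ, 0 < δ → δ ≤ δ₀ →
      ∀ m : ℕ, m < k →
      ∀ a y : Fin m → ℝ, HasRealRoots a y →
      ∀ lam : Fin n → ℝ,
        Fin.append lam y ∈ gardingCone k (n + m) →
        sigma k (Fin.append lam y) = s →
        Antitone lam →
        -δ * lam ⟨0, by omega⟩ ≤ lam ⟨n - 1, by omega⟩ →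
        Λ ≤ lam ⟨0, by omega⟩ →
        (∀ j : Fin m, Λ * |y j| ≤ lam ⟨0, by omega⟩) →
      ∀ ξ : Fin n → ℝ,
        let F : (Fin n → ℝ) → ℝ := sumHessian k a
        let i₁ : Fin n := ⟨0, by omega⟩
        let γ : ℝ := 1 / (1 + 16 * (k : ℝ));
        -(∑ p : Fin n, ∑ q ∈ Finset.univ.erase p,
              partialD q (partialD p F) lam * ξ p * ξ q / F lam)
            + 2 * ((∑ i : Fin n, partialD i F lam * ξ i) ^ 2 / F lam ^ 2)
            + 2 * ∑ i ∈ Finset.Ioi i₁,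
                partialD i F lam * ξ i ^ 2 / ((1 + 2 * δ) * lam i₁ * F lam)
          ≥ (1 + γ) * (partialD i₁ F lam * ξ i₁ ^ 2 / (lam i₁ * F lam)) := by
  have hn0 : 0 < n := by omega
  rcases k with _ | _ | K
  · exact ⟨1 / 2, by norm_num, by norm_num, 1, one_pos, fun δ _ _ m hm => absurd hm (by omega)⟩
  -- For `k = 1` one has `m = 0` and `∑ λ_i = s`. The variables other than `λ_1` sum to at least
  -- `-λ_1 / 2`, so `λ_1 ≤ 2 |s|`, and this choice of `Λ` makes the case vacuous.
  · refine ⟨1 / (2 * n), by positivity, ?_, 2 * |s| + 1, by positivity, ?_⟩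
    · rw [div_lt_one (by positivity)]
      have : (3 : ℝ) ≤ n := by exact_mod_cast hn
      linarith
    intro δ hδ hδ₀ m hm a y _ lam _ hs hanti hlow hΛ _
    exfalso
    obtain rfl : m = 0 := by omega
    rw [sigma_eq_esymmOn, esymmOn_one, Fin.sum_univ_add] at hs
    simp only [Fin.append_left, Finset.univ_eq_empty, Finset.sum_empty, add_zero] at hs
    set i₁ : Fin n := ⟨0, by omega⟩
    rw [← Finset.add_sum_erase univ lam (mem_univ i₁)] at hs
    have hpos : 0 < lam i₁ := by linarith [abs_nonneg s]
    have h1 : (univ.erase i₁).card • (-δ * lam i₁) ≤ ∑ i ∈ univ.erase i₁, lam i :=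
      Finset.card_nsmul_le_sum _ _ _ fun i _ => hlow.trans (hanti (by
        have := i.2
        exact Fin.le_def.2 (by simp; omega)))
    have h2 : ((univ.erase i₁).card : ℝ) * (δ * lam i₁) ≤ n * (1 / (2 * n) * lam i₁) := by
      gcongr
      exact (Finset.card_erase_le).trans (by simp)
    have h3 : (n : ℝ) * (1 / (2 * n) * lam i₁) = lam i₁ / 2 := by field_simp
    rw [nsmul_eq_mul] at h1
    linarith [le_abs_self s]
  -- Here `2 n` bounds the number `n + m` of variables, uniformly in `m < k ≤ n`.
  · obtain ⟨ε, hεdef⟩ : ∃ ε : ℝ, ε =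
      1 / (100 * (K + 3) * (100 * ((2 * n : ℕ) + 1) * (2 * K + 12) ^ 2)) := ⟨_, rfl⟩
    have hε : 0 < ε := by rw [hεdef]; positivity
    have hεN : 100 * ((K : ℝ) + 3) * (100 * ((2 * n : ℕ) + 1) * (2 * K + 12) ^ 2 * ε) ≤ 1 := by
      rw [hεdef]
      apply le_of_eq
      field_simp
    have hε1 := (small_parameter_bounds (Nat.cast_nonneg K) (Nat.cast_nonneg _) hε hεN).1
    obtain ⟨η, hη, H⟩ := exists_isSplitting (2 * n) K hε hε1
    -- In `Λ`, the term `1 / η` gives `|y_j| ≤ η λ_1`, the term `|s| / η` makes the rescaled `σ_k`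
    -- at most `η`, and the `1` ensures `λ_1 ≥ 1`.
    refine ⟨min (min ε η) (1 / 2), by positivity, (min_le_right _ _).trans_lt (by norm_num),
      1 + 1 / η + |s| / η, by positivity, ?_⟩
    intro δ hδ hδ₀ m hm a y hroots lam hcone hs hanti hlow hΛ hy ξ
    have hδε : δ ≤ ε := hδ₀.trans ((min_le_left _ _).trans (min_le_left _ _))
    have hδη : δ ≤ η := hδ₀.trans ((min_le_left _ _).trans (min_le_right _ _))
    have hδ2 : δ ≤ 1 / 2 := hδ₀.trans (min_le_right _ _)
    intro F i₁ γ
    change -δ * lam i₁ ≤ _ at hlow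
    change _ ≤ lam i₁ at hΛ
    change ∀ j, _ ≤ lam i₁ at hy
    have hη' : 0 < 1 / η := by positivity
    have hsη : 0 ≤ |s| / η := by positivity
    have hL1 : 1 ≤ lam i₁ := by linarith
    have hL : 0 < lam i₁ := by linarith
    have hlam : ∀ i, |lam i| ≤ lam i₁ ∧ -(δ * lam i₁) ≤ lam i := by
      intro i
      have h1 : lam i ≤ lam i₁ := hanti (Fin.le_def.2 (Nat.zero_le _))
      have h2 : -δ * lam i₁ ≤ lam i := hlow.trans (hanti (by
        have := i.2
        exact Fin.le_def.2 (by simp; omega)))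
      exact ⟨_root_.abs_le.2 ⟨by nlinarith, h1⟩, by linarith⟩
    have hyη : ∀ j, |y j| ≤ lam i₁ ∧ |y j| ≤ η * lam i₁ := by
      intro j
      have h1 := hy j
      have h2 := abs_nonneg (y j)
      have h3 : 1 / η * |y j| ≤ lam i₁ := by nlinarith
      refine ⟨by nlinarith, ?_⟩
      calc |y j| = η * (1 / η * |y j|) := by field_simp
        _ ≤ _ := by gcongr
    have hcone' := append_gardingCone_inCone hcone
    have hFpos := hcone' _ le_rfl
    have hi₁ : Fin.append lam y (Fin.castAdd m i₁) = lam i₁ := Fin.append_left _ _ _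
    have habs : ∀ i ∈ (univ : Finset (Fin (n + m))), |(lam i₁)⁻¹ * Fin.append lam y i| ≤ 1 := by
      intro i _
      rw [abs_mul, abs_of_pos (inv_pos.2 hL), inv_mul_le_one₀ hL]
      induction i using Fin.addCases with
      | left i => rw [Fin.append_left]; exact (hlam i).1
      | right j => rw [Fin.append_right]; exact (hyη j).1
    have hlow' : ∀ i ∈ (univ : Finset (Fin (n + m))), -η ≤ (lam i₁)⁻¹ * Fin.append lam y i := by
      intro i _
      rw [le_inv_mul_iff₀ hL]
      induction i using Fin.addCases with
      | left i =>
        rw [Fin.append_left]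
        refine le_trans ?_ (hlam i).2
        have : δ * lam i₁ ≤ η * lam i₁ := by gcongr
        linarith
      | right j =>
        rw [Fin.append_right]
        linarith [(_root_.abs_le.1 (hyη j).2).1]
    have hx₁ : (lam i₁)⁻¹ * Fin.append lam y (Fin.castAdd m i₁) = 1 := by
      rw [hi₁]; field_simp
    have hsmall : esymmOn (fun i => (lam i₁)⁻¹ * Fin.append lam y i) univ (K + 2) ≤ η := by
      rw [esymmOn_smul, ← sigma_eq_esymmOn, hs, inv_pow, inv_mul_le_iff₀ (by positivity)]
      have h1 : lam i₁ ≤ lam i₁ ^ (K + 2) := le_self_pow₀ hL1 (by omega)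
      have h2 : |s| / η ≤ lam i₁ := by linarith
      rw [div_le_iff₀ hη] at h2
      calc s ≤ |s| := le_abs_self s
        _ ≤ lam i₁ * η := h2
        _ ≤ _ := by gcongr
    have hN : (univ : Finset (Fin (n + m))).card ≤ 2 * n := by
      rw [Finset.card_univ, Fintype.card_fin]; omega
    have hconeS := hcone'.smul (inv_pos.2 hL)
    obtain ⟨A, P⟩ := H _ univ (Fin.castAdd m i₁) hN (mem_univ _) hconeS hx₁ habs hlow' hsmall
    have hγ0 : 0 ≤ γ := by positivity
    -- This is `11 (k + 1) ≤ 1 + 16 k`, an equality at `k = 2`.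
    have hγ : 11 * ((K : ℝ) + 3) * γ ≤ 1 := by
      have hK : (0 : ℝ) ≤ K := Nat.cast_nonneg K
      change 11 * ((K : ℝ) + 3) * (1 / (1 + 16 * ((K + 1 + 1 : ℕ) : ℝ))) ≤ 1
      rw [mul_one_div, div_le_one (by positivity)]
      push_cast
      linarith
    have hmain := P.concavity hN hconeS hε hx₁ habs hδ.le hδε hγ0 hγ hεN
      (Fin.append ξ (0 : Fin m → ℝ))
    have hIoi : Finset.Ioi i₁ = univ.erase i₁ := by
      ext i
      simp only [Finset.mem_Ioi, Finset.mem_erase, Finset.mem_univ, and_true, Fin.lt_def, ne_eq,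
        Fin.ext_iff]
      change 0 < (i : ℕ) ↔ ¬ (i : ℕ) = 0
      omega
    rw [hIoi]
    exact hroots.concavity_of_esymmOn hm (concavity_of_scaled hL hFpos hmain)
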